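/- Let $d\ge 2$, $1<p<\infty$, let $\Omega\subset\mathbb{R}^d$ be a bounded open set and let $D\subset\Omega$ be a nonempty open set with Lipschitz boundary. Let $\sigma\colon\Omega\to\mathbb{R}$ be measurable with $\sigma=1$ on $\Omega\setminus D$, and suppose that there are constants $a,b$ such that either $0<a<\sigma(x)<b<1$ for all $x\in D$, or $1<a<\sigma(x)<b<\infty$ for all $x\in D$. For a conductivity $\gamma$ on $\Omega$ (here $\gamma=\sigma$ or $\gamma=1$) let $X=W^{1,p}(\Omega)/W^{1,p}_0(\Omega)$ and let $\Lambda_\gamma\colon X\to X'$ be the weak Dirichlet to Neumann map $$\langle\Lambda_\gamma f,g\rangle=\int_\Omega\gamma|\nabla u|^{p-2}\nabla u\cdot\nabla\bar g\,dx,$$ where $u\in W^{1,p}(\Omega)$ minimizes $\int_\Omega\gamma|\nabla u|^p\,dx$ among functions with boundary values $f$, and $\bar g\in W^{1,p}(\Omega)$ is any extension of $g$. Let $w\in C^2(\mathbb{R})$ solve $w''+V(w,w')w=0$ on $\mathbb{R}$ with $(w(0),w'(0))\neq(0,0)$, where $$V(a,b)=\frac{(2p-3)b^2+(p-1)a^2}{(p-1)b^2+a^2}.$$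 For $t\in\mathbb{R}$, $\tau>0$ and $\rho,\rho^\perp\in\mathbb{R}^d$ with $|\rho|=|\rho^\perp|=1$ and $\rho\cdot\rho^\perp=0$ (below called an orthonormal pair), let $f(x)=e^{\tau(\rho\cdot x-t)}w(\tau\rho^\perp\cdot x)$ be the corresponding Wolff solution, considered as an element of $X$, and define the indicator function $$I(t,\rho,\rho^\perp,\tau)=\tau^{d-p}\langle(\Lambda_\sigma-\Lambda_1)f,f\rangle .$$ Write $h_D(\rho)=\sup_{x\in D}x\cdot\rho$. Then: 1. There exist constants $c,C,\tau_0>0$ such that for every orthonormal pair $\rho,\rho^\perp$ and every $\tau\ge\tau_0$ $$c<\left|I(h_D(\rho),\rho,\rho^\perp,\tau)\right|<C\tau^d .$$ 2. For every orthonormal pair $\rho,\rho^\perp$: if $t>h_D(\rho)$, then $I(t,\rho,\rho^\perp,\tau)\to0$ as $\tau\to\infty$; if $t<h_D(\rho)$, then $|I(t,\rho,\rho^\perp,\tau)|\to\infty$ as $\tau\to\infty$. 3. Consequently the convex hull of $D$ is determined by the indicator function: it is the interior of the set of all $x\in\mathbb{R}^d$ such that $\rho\cdot x\le t$ for every orthonormal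 pair $\rho,\rho^\perp$ and every $t\in\mathbb{R}$ with $\lim_{\tau\to\infty}I(t,\rho,\rho^\perp,\tau)=0$. -/

import Mathlib

open MeasureTheory Filter Topology
open scoped ContDiff

namespace Enclosure

noncomputable section

/-- Euclidean space `ℝᵈ`. -/
abbrev E (d : ℕ) : Type := EuclideanSpace ℝ (Fin d)

instance factOneLeOfReal {p : ℝ} [hp : Fact (1 < p)] : Fact (1 ≤ ENNReal.ofReal p) :=
  ⟨ENNReal.one_le_ofReal.2 hp.out.le⟩

/-- `φ ∈ C_c^∞(Ω)`. -/
def IsTestFunction {d : ℕ} (Ω : Set (E d)) (φ : E d → ℝ) : Prop :=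
  ContDiff ℝ ∞ φ ∧ HasCompactSupport φ ∧ tsupport φ ⊆ Ω

/-- `G` is the weak gradient of `u` in `Ω`:
`∫_Ω u ∂_v φ = - ∫_Ω (G · v) φ` for all test functions `φ` and all directions `v`. -/
def IsWeakGradient {d : ℕ} (Ω : Set (E d)) (u : E d → ℝ) (G : E d → E d) : Prop :=
  ∀ φ : E d → ℝ, IsTestFunction Ω φ → ∀ v : E d,
    ∫ x in Ω, u x * fderiv ℝ φ x v = - ∫ x in Ω, inner ℝ (G x) v * φ x

theorem integrable_mul_fderiv_test {d : ℕ} {Ω : Set (E d)} {p : ℝ} [Fact (1 < p)]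
    (u : Lp ℝ (ENNReal.ofReal p) (volume.restrict Ω)) {φ : E d → ℝ}
    (hφ : IsTestFunction Ω φ) (v : E d) :
    Integrable (fun x => u x * fderiv ℝ φ x v) (volume.restrict Ω) := by
  have hu : LocallyIntegrable (fun x => u x) (volume.restrict Ω) :=
    (Lp.memLp u).locallyIntegrable Fact.out
  have hc : Continuous (fun x => fderiv ℝ φ x v) :=
    (hφ.1.continuous_fderiv (by simp)).clm_apply continuous_const
  have hs : HasCompactSupport (fun x => fderiv ℝ φ x v) := hφ.2.1.fderiv_apply (𝕜 := ℝ) v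
  have := hu.integrable_smul_left_of_hasCompactSupport hc hs
  simpa [smul_eq_mul, mul_comm] using this

theorem integrable_inner_mul_test {d : ℕ} {Ω : Set (E d)} {p : ℝ} [Fact (1 < p)]
    (G : Lp (E d) (ENNReal.ofReal p) (volume.restrict Ω)) {φ : E d → ℝ}
    (hφ : IsTestFunction Ω φ) (v : E d) :
    Integrable (fun x => inner ℝ (G x) v * φ x) (volume.restrict Ω) := by
  have hG : LocallyIntegrable (fun x => G x) (volume.restrict Ω) :=
    (Lp.memLp G).locallyIntegrable Fact.out
  have := (hG.integrable_smul_left_of_hasCompactSupport hφ.1.continuous hφ.2.1).inner_const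
    (𝕜 := ℝ) v
  simpa [inner_smul_left, mul_comm] using this

/-- The Sobolev space `W^{1,p}(Ω)`, as the space of pairs `(u, ∇u)` in `L^p(Ω) × L^p(Ω; ℝᵈ)`.
Its norm is `max (‖u‖_p, ‖∇u‖_p)`, which is equivalent to the usual Sobolev norm. -/
def W1p {d : ℕ} (Ω : Set (E d)) (p : ℝ) [Fact (1 < p)] :
    Submodule ℝ (Lp ℝ (ENNReal.ofReal p) (volume.restrict Ω) ×
      Lp (E d) (ENNReal.ofReal p) (volume.restrict Ω)) where
  carrier := {v | IsWeakGradient Ω v.1 v.2}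
  zero_mem' := by
    intro φ _ v
    have h1 : ∫ x in Ω, (0 : Lp ℝ (ENNReal.ofReal p) (volume.restrict Ω)) x * fderiv ℝ φ x v = 0 := by
      rw [← integral_zero (E d) ℝ (μ := volume.restrict Ω)]
      refine integral_congr_ae ?_
      filter_upwards [Lp.coeFn_zero ℝ (ENNReal.ofReal p) (volume.restrict Ω)] with x hx
      rw [hx]; simp
    have h2 : ∫ x in Ω,
        inner ℝ ((0 : Lp (E d) (ENNReal.ofReal p) (volume.restrict Ω)) x) v * φ x = 0 := by
      rw [← integral_zero (E d) ℝ (μ := volume.restrict Ω)]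
      refine integral_congr_ae ?_
      filter_upwards [Lp.coeFn_zero (E d) (ENNReal.ofReal p) (volume.restrict Ω)] with x hx
      rw [hx]; simp
    exact h1.trans (by rw [← neg_eq_zero] at h2; exact h2.symm)
  add_mem' := by
    intro a b ha hb φ hφ v
    have h1 : ∫ x in Ω, (a + b).1 x * fderiv ℝ φ x v
        = ∫ x in Ω, (a.1 x * fderiv ℝ φ x v + b.1 x * fderiv ℝ φ x v) := by
      refine integral_congr_ae ?_
      filter_upwards [Lp.coeFn_add a.1 b.1] with x hx
      rw [Prod.fst_add, hx, Pi.add_apply, add_mul]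
    have h2 : ∫ x in Ω, inner ℝ ((a + b).2 x) v * φ x
        = ∫ x in Ω, (inner ℝ (a.2 x) v * φ x + inner ℝ (b.2 x) v * φ x) := by
      refine integral_congr_ae ?_
      filter_upwards [Lp.coeFn_add a.2 b.2] with x hx
      rw [Prod.snd_add, hx, Pi.add_apply, inner_add_left, add_mul]
    rw [h1, h2, integral_add (integrable_mul_fderiv_test _ hφ v) (integrable_mul_fderiv_test _ hφ v),
      integral_add (integrable_inner_mul_test _ hφ v) (integrable_inner_mul_test _ hφ v),
      ha φ hφ v, hb φ hφ v, neg_add]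
  smul_mem' := by
    intro c a ha φ hφ v
    have h1 : ∫ x in Ω, (c • a).1 x * fderiv ℝ φ x v
        = ∫ x in Ω, c * (a.1 x * fderiv ℝ φ x v) := by
      refine integral_congr_ae ?_
      filter_upwards [Lp.coeFn_smul c a.1] with x hx
      rw [Prod.smul_fst, hx, Pi.smul_apply, smul_eq_mul, mul_assoc]
    have h2 : ∫ x in Ω, inner ℝ ((c • a).2 x) v * φ x
        = ∫ x in Ω, c * (inner ℝ (a.2 x) v * φ x) := by
      refine integral_congr_ae ?_
      filter_upwards [Lp.coeFn_smul c a.2] with x hx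
      rw [Prod.smul_snd, hx, Pi.smul_apply, real_inner_smul_left, mul_assoc]
    rw [h1, h2, integral_const_mul, integral_const_mul, ha φ hφ v, mul_neg]

/-- The elements of `W^{1,p}(Ω)` given by test functions. -/
def testSubmodule {d : ℕ} (Ω : Set (E d)) (p : ℝ) [Fact (1 < p)] :
    Submodule ℝ (W1p Ω p) where
  carrier := {v | ∃ φ : E d → ℝ, IsTestFunction Ω φ ∧ v.1.1 =ᵐ[volume.restrict Ω] φ}
  zero_mem' := ⟨fun _ => 0, ⟨contDiff_const, HasCompactSupport.zero, by simp [tsupport]⟩,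
    Lp.coeFn_zero ℝ (ENNReal.ofReal p) (volume.restrict Ω)⟩
  add_mem' := by
    rintro a b ⟨φ, hφ, ha⟩ ⟨ψ, hψ, hb⟩
    refine ⟨φ + ψ, ⟨hφ.1.add hψ.1, hφ.2.1.add hψ.2.1, ?_⟩, ?_⟩
    · exact (tsupport_add φ ψ).trans (Set.union_subset hφ.2.2 hψ.2.2)
    · exact (Lp.coeFn_add a.1.1 b.1.1).trans (ha.add hb)
  smul_mem' := by
    rintro c a ⟨φ, hφ, ha⟩
    refine ⟨c • φ, ⟨hφ.1.const_smul c, hφ.2.1.smul_left (f := fun _ => c), ?_⟩, ?_⟩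
    · exact (tsupport_smul_subset_right (fun _ => c) φ).trans hφ.2.2
    · exact (Lp.coeFn_smul c a.1.1).trans (ha.const_smul c)

/-- `W_0^{1,p}(Ω)`, the closure of `C_c^∞(Ω)` in `W^{1,p}(Ω)`. -/
def W01p {d : ℕ} (Ω : Set (E d)) (p : ℝ) [Fact (1 < p)] : Submodule ℝ (W1p Ω p) :=
  (testSubmodule Ω p).topologicalClosure

/-- The space of abstract boundary values `X = W^{1,p}(Ω) / W_0^{1,p}(Ω)`. -/
abbrev BoundarySpace {d : ℕ} (Ω : Set (E d)) (p : ℝ) [Fact (1 < p)] : Type :=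
  W1p Ω p ⧸ W01p Ω p

/-- The boundary values of an element of `W^{1,p}(Ω)`. -/
def boundaryValue {d : ℕ} (Ω : Set (E d)) (p : ℝ) [Fact (1 < p)] (u : W1p Ω p) :
    BoundarySpace Ω p :=
  Submodule.Quotient.mk u

open Classical in
/-- The boundary values in `X` of a function `f` which belongs to `W^{1,p}(Ω)`
(and `0` when it does not). -/
def boundaryValueOfFun {d : ℕ} (Ω : Set (E d)) (p : ℝ) [Fact (1 < p)] (f : E d → ℝ) :
    BoundarySpace Ω p :=
  if h : ∃ u : W1p Ω p, u.1.1 =ᵐ[volume.restrict Ω] f then boundaryValue Ω p h.choose else 0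

/-- The energy `∫_Ω σ |∇u|^p`. -/
def energy {d : ℕ} (Ω : Set (E d)) (p : ℝ) [Fact (1 < p)] (σ : E d → ℝ) (u : W1p Ω p) : ℝ :=
  ∫ x in Ω, σ x * ‖u.1.2 x‖ ^ p

/-- `u` minimizes the energy among all functions with boundary values `f`. -/
def IsMinimizer {d : ℕ} (Ω : Set (E d)) (p : ℝ) [Fact (1 < p)] (σ : E d → ℝ)
    (f : BoundarySpace Ω p) (u : W1p Ω p) : Prop :=
  boundaryValue Ω p u = f ∧
    ∀ v : W1p Ω p, boundaryValue Ω p v = f → energy Ω p σ u ≤ energy Ω p σ v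

/-- The form `∫_Ω σ |∇u|^{p-2} ∇u · ∇g`. -/
def flux {d : ℕ} (Ω : Set (E d)) (p : ℝ) [Fact (1 < p)] (σ : E d → ℝ) (u g : W1p Ω p) : ℝ :=
  ∫ x in Ω, σ x * ‖u.1.2 x‖ ^ (p - 2) * inner ℝ (u.1.2 x) (g.1.2 x)

/-- The weak Dirichlet to Neumann map `Λ_σ` from `X` to the dual of `X`. For boundary values `f`, the functional
`Λ_σ f` is the one with `⟨Λ_σ f, g⟩ = ∫_Ω σ |∇u|^{p-2} ∇u · ∇ḡ`, where `u` minimizes the energy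
with boundary values `f`, and `ḡ` is any extension of `g`. -/
def dnMap {d : ℕ} (Ω : Set (E d)) (p : ℝ) [Fact (1 < p)] (σ : E d → ℝ)
    (f : BoundarySpace Ω p) : StrongDual ℝ (BoundarySpace Ω p) :=
  Classical.epsilon fun L : StrongDual ℝ (BoundarySpace Ω p) =>
    ∃ u : W1p Ω p, IsMinimizer Ω p σ f u ∧
      ∀ g : W1p Ω p, L (boundaryValue Ω p g) = flux Ω p σ u g

/-- The coefficient `V(a,b) = ((2p-3) b² + (p-1) a²) / ((p-1) b² + a²)` of the equation
of Wolff. -/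
def wolffV (p a b : ℝ) : ℝ :=
  ((2 * p - 3) * b ^ 2 + (p - 1) * a ^ 2) / ((p - 1) * b ^ 2 + a ^ 2)

/-- `w` solves `w'' + V(w, w') w = 0` on the real line, with initial data
`(w(0), w'(0)) ≠ (0, 0)`. -/
def IsWolffProfile (p : ℝ) (w : ℝ → ℝ) : Prop :=
  ContDiff ℝ 2 w ∧ (w 0, deriv w 0) ≠ (0, 0) ∧
    ∀ s : ℝ, deriv (deriv w) s + wolffV p (w s) (deriv w s) * w s = 0

/-- The Wolff solution `x ↦ e^{τ (ρ · x - t)} w(τ ρ^⊥ · x)`. -/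
def wolffSolution {d : ℕ} (w : ℝ → ℝ) (t : ℝ) (ρ ρ' : E d) (τ : ℝ) (x : E d) : ℝ :=
  Real.exp (τ * (inner ℝ ρ x - t)) * w (τ * inner ℝ ρ' x)

/-- The indicator function
`I(t, ρ, ρ^⊥, τ) = τ^{d-p} ⟨(Λ_σ - Λ_1) f, f⟩`, with `f` the boundary values of the Wolff
solution. -/
def indicatorFun {d : ℕ} (Ω : Set (E d)) (p : ℝ) [Fact (1 < p)] (σ : E d → ℝ) (w : ℝ → ℝ)
    (t : ℝ) (ρ ρ' : E d) (τ : ℝ) : ℝ :=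
  τ ^ ((d : ℝ) - p) *
    (dnMap Ω p σ (boundaryValueOfFun Ω p (wolffSolution w t ρ ρ' τ)) -
      dnMap Ω p (fun _ => 1) (boundaryValueOfFun Ω p (wolffSolution w t ρ ρ' τ)))
      (boundaryValueOfFun Ω p (wolffSolution w t ρ ρ' τ))

/-- `D` has Lipschitz boundary: near each boundary point, and after a rotation which takes some
unit vector `e` to the vertical direction, `D` is the part of space above the graph of a
Lipschitz function `g` of the horizontal variable `x - (e · x) e`. -/
def HasLipschitzBoundary {d : ℕ} (D : Set (E d)) : Prop :=
  ∀ x₀ ∈ frontier D, ∃ (e : E d) (K : NNReal) (g : E d → ℝ), ‖e‖ = 1 ∧ LipschitzWith K g ∧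
    ∀ᶠ x in 𝓝 x₀, x ∈ D ↔ g (x - inner ℝ e x • e) < inner ℝ e x

/-- `σ` is equal to one in `Ω \ D`, and inside the inclusion `D` it is either bounded
between two constants in `]0,1[`, or bounded between two constants in `]1,∞[`. -/
def IsFiniteInclusion {d : ℕ} (Ω D : Set (E d)) (σ : E d → ℝ) : Prop :=
  (∀ x ∈ Ω \ D, σ x = 1) ∧
    ((∃ a b : ℝ, 0 < a ∧ b < 1 ∧ ∀ x ∈ D, a < σ x ∧ σ x < b) ∨
      (∃ a b : ℝ, 1 < a ∧ ∀ x ∈ D, a < σ x ∧ σ x < b))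

/-- The support function `sup_{x ∈ D} x · ρ`. -/
def supportFun {d : ℕ} (D : Set (E d)) (ρ : E d) : ℝ :=
  sSup ((fun x => inner ℝ ρ x) '' D)

end

end Enclosure

namespace Enclosure

/-! ### The profile of a Wolff solution -/

section Profile

variable {p : ℝ} {w : ℝ → ℝ}

/-! A Wolff solution `u` is `p`-harmonic on all of space, so it is itself a minimizer for
conductivity one. Using `u` as a competitor in the problem for `σ` gives `⟨(Λ_σ - Λ_1) f, f⟩ ≤ (b -
1) ∫_D |∇u|^p`. Young's inequality with weight `a` on `D`, combined with the weak equation for `u`,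
gives the lower bound `(p - 1)(1 - a^(-1/(p-1))) ∫_D |∇u|^p` (`dnMap_sub_bounds`). Since `σ` stays
on one side of one in `D`, the two constants have the same sign, and the pairing is comparable in
absolute value to `∫_D |∇u|^p`.

By orthonormality `|∇u|^p = τ^p e^{pτ(ρ·x - t)} (w² + w'²)^{p/2}`, the profile being evaluated at `τ
ρ^⊥·x`. A first integral of the equation keeps `w² + w'²` between positive constants
(`exists_radiusSq_bounds`). Hence `|I|` is comparable to `τ^d ∫_D e^{pτ(ρ·x - t)} dx`, uniformly
over orthonormal pairs (`exists_indicatorFun_bounds`).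

At `t = h_D(ρ)` the exponential is at most one on `D`, which gives the upper bound. An interior cone
at a supporting boundary point contains a ball of radius of order `1/τ` at distance `1/τ`, where the
exponential is bounded below; this gives the lower bound (`exists_le_integral_exp`). Moving `t`
multiplies the integral by `e^{pτ(h_D(ρ) - t)}`, whence the dichotomy. The hull then follows from
Hahn–Banach. -/

theorem IsWolffProfile.hasDerivAt (hw : IsWolffProfile p w) (s : ℝ) :
    HasDerivAt w (deriv w s) s :=
  (hw.1.differentiable (by norm_num) s).hasDerivAt

theorem IsWolffProfile.contDiff_deriv (hw : IsWolffProfile p w) : ContDiff ℝ 1 (deriv w) :=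
  (contDiff_succ_iff_deriv.1 (show ContDiff ℝ (1 + 1) w by simpa [one_add_one_eq_two] using hw.1)).2.2

theorem IsWolffProfile.hasDerivAt_deriv (hw : IsWolffProfile p w) (s : ℝ) :
    HasDerivAt (deriv w) (-(wolffV p (w s) (deriv w s) * w s)) s := by
  have h := (hw.contDiff_deriv.differentiable (by norm_num) s).hasDerivAt
  rwa [eq_neg_of_add_eq_zero_left (hw.2.2 s)] at h

theorem wolffV_denom_pos (hp : 1 < p) {a b : ℝ} (h : 0 < a ^ 2 + b ^ 2) :
    0 < (p - 1) * b ^ 2 + a ^ 2 := by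
  rcases eq_or_ne b 0 with rfl | hb
  · simpa using h
  · have : 0 < (p - 1) * b ^ 2 := mul_pos (by linarith) (by positivity)
    positivity

theorem one_sub_wolffV (hp : 1 < p) {a b : ℝ} (h : 0 < a ^ 2 + b ^ 2) :
    1 - wolffV p a b = (2 - p) * (a ^ 2 + b ^ 2) / ((p - 1) * b ^ 2 + a ^ 2) := by
  have := (wolffV_denom_pos hp h).ne'
  rw [wolffV, eq_div_iff this, sub_mul, div_mul_cancel₀ _ this]
  ring

/-- `w² + w'²` for a profile `w`. -/
noncomputable def radiusSq (w : ℝ → ℝ) (s : ℝ) : ℝ := w s ^ 2 + deriv w s ^ 2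

theorem IsWolffProfile.hasDerivAt_radiusSq (hw : IsWolffProfile p w) (s : ℝ) :
    HasDerivAt (radiusSq w) (2 * w s * deriv w s * (1 - wolffV p (w s) (deriv w s))) s := by
  have h := ((hw.hasDerivAt s).pow 2).add ((hw.hasDerivAt_deriv s).pow 2)
  refine h.congr_deriv ?_
  simp only [Nat.cast_ofNat]
  ring

theorem radiusSq_nonneg (s : ℝ) : 0 ≤ radiusSq w s := by unfold radiusSq; positivity

theorem radiusSq_zero_pos (hw : IsWolffProfile p w) : 0 < radiusSq w 0 := by
  refine lt_of_le_of_ne (radiusSq_nonneg 0) fun h => hw.2.1 ?_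
  unfold radiusSq at h
  have h1 : w 0 = 0 := by nlinarith [sq_nonneg (w 0), sq_nonneg (deriv w 0)]
  have h2 : deriv w 0 = 0 := by nlinarith [sq_nonneg (w 0), sq_nonneg (deriv w 0)]
  rw [h1, h2]

/-- Along a profile the left side is `|R'|` with `R = w² + w'²`, so this is the differential
inequality `|R'| ≤ C R` needed for a Grönwall argument. -/
theorem exists_abs_deriv_radiusSq_le (hp : 1 < p) :
    ∃ C : ℝ, ∀ a b : ℝ, |2 * a * b * (1 - wolffV p a b)| ≤ C * (a ^ 2 + b ^ 2) := by
  refine ⟨|2 - p| * (1 + 1 / (p - 1)), fun a b => ?_⟩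
  have hp' : 0 < p - 1 := by linarith
  rcases (by positivity : 0 ≤ a ^ 2 + b ^ 2).eq_or_lt with h | h
  · have h1 : a = 0 := by nlinarith [sq_nonneg a, sq_nonneg b]
    have h2 : b = 0 := by nlinarith [sq_nonneg a, sq_nonneg b]
    simp [h1, h2]
  · have hN := wolffV_denom_pos hp h
    have h1 : |2 * a * b| ≤ a ^ 2 + b ^ 2 := by
      rw [abs_le]; constructor <;> nlinarith [sq_nonneg (a + b), sq_nonneg (a - b)]
    have h2 : |1 - wolffV p a b| ≤ |2 - p| * (1 + 1 / (p - 1)) := by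
      rw [one_sub_wolffV hp h, mul_div_assoc, abs_mul]
      refine mul_le_mul_of_nonneg_left ?_ (abs_nonneg _)
      rw [abs_of_pos (div_pos h hN), div_le_iff₀ hN]
      have : (1 + 1 / (p - 1)) * ((p - 1) * b ^ 2 + a ^ 2)
          = (a ^ 2 + b ^ 2) + ((p - 1) * b ^ 2 + 1 / (p - 1) * a ^ 2) := by
        field_simp; ring
      rw [this]
      have : 0 ≤ (p - 1) * b ^ 2 + 1 / (p - 1) * a ^ 2 := by positivity
      linarith
    rw [abs_mul, mul_comm]
    exact mul_le_mul h2 h1 (abs_nonneg _) (by positivity)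

/-- Grönwall in both directions: `R e^{Cs}` is nondecreasing and `R e^{-Cs}` nonincreasing, so
positivity at `0` propagates. This replaces an appeal to uniqueness for an equation whose
coefficient is singular at the origin of the phase plane. -/
theorem IsWolffProfile.radiusSq_pos (hp : 1 < p) (hw : IsWolffProfile p w) (s : ℝ) :
    0 < radiusSq w s := by
  obtain ⟨C, hC⟩ := exists_abs_deriv_radiusSq_le hp
  have hexp (c : ℝ) (s : ℝ) : HasDerivAt (fun s => radiusSq w s * Real.exp (c * s))
      ((2 * w s * deriv w s * (1 - wolffV p (w s) (deriv w s)) + c * radiusSq w s)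
        * Real.exp (c * s)) s := by
    have h := (hw.hasDerivAt_radiusSq s).mul (((hasDerivAt_id s).const_mul c).exp)
    refine h.congr_deriv ?_
    simp only [id]
    ring
  have hb (s : ℝ) := abs_le.1 (hC (w s) (deriv w s))
  have h0 := radiusSq_zero_pos hw
  rcases le_total 0 s with hs | hs
  · have hmono : Monotone (fun s => radiusSq w s * Real.exp (C * s)) :=
      monotone_of_hasDerivAt_nonneg (hexp C) fun s =>
        mul_nonneg (by have := (hb s).1; unfold radiusSq; linarith) (Real.exp_pos _).le
    have := hmono hs
    simp only [mul_zero, Real.exp_zero, mul_one] at this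
    exact pos_of_mul_pos_left (h0.trans_le this) (Real.exp_pos _).le
  · have hanti : Antitone (fun s => radiusSq w s * Real.exp (-C * s)) :=
      antitone_of_hasDerivAt_nonpos (hexp (-C)) fun s =>
        mul_nonpos_of_nonpos_of_nonneg (by have := (hb s).2; unfold radiusSq; linarith)
          (Real.exp_pos _).le
    have := hanti hs
    simp only [mul_zero, Real.exp_zero, mul_one] at this
    exact pos_of_mul_pos_left (h0.trans_le this) (Real.exp_pos _).le

/-- The first integral of the equation of Wolff. -/
noncomputable def firstIntegral (p : ℝ) (w : ℝ → ℝ) (s : ℝ) : ℝ :=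
  Real.log (radiusSq w s) + (2 - p) / (p - 1) * (deriv w s ^ 2 / radiusSq w s)

/-- With `a = w`, `b = w'`, `R = a² + b²` and `N = (p-1)b² + a²`, one has `(log R)' = 2(2-p)ab/N`.
The identity `V a² + b² = (p-1)R²/N` gives `(b²/R)' = -2(p-1)ab/N`. The two are proportional. -/
theorem IsWolffProfile.hasDerivAt_firstIntegral (hp : 1 < p) (hw : IsWolffProfile p w) (s : ℝ) :
    HasDerivAt (firstIntegral p w) 0 s := by
  have hR := hw.radiusSq_pos hp s
  have h := ((hw.hasDerivAt_radiusSq s).log hR.ne').add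
    ((((hw.hasDerivAt_deriv s).pow 2).div (hw.hasDerivAt_radiusSq s) hR.ne').const_mul
      ((2 - p) / (p - 1)))
  refine h.congr_deriv ?_
  have hp' : p - 1 ≠ 0 := by linarith
  have hN := (wolffV_denom_pos hp hR).ne'
  simp only [radiusSq, Pi.pow_apply, wolffV] at hR ⊢
  generalize w s = a at hR hN ⊢
  generalize deriv w s = b at hR hN ⊢
  have hR' := hR.ne'
  obtain ⟨k, rfl⟩ : ∃ k, p = k + 1 := ⟨p - 1, by ring⟩
  simp only [add_sub_cancel_right] at *
  obtain ⟨N, hNeq⟩ : ∃ N, k * b ^ 2 + a ^ 2 = N := ⟨_, rfl⟩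
  rw [hNeq] at hN ⊢
  field_simp
  rw [← hNeq]
  ring

/-- Along a profile, `w² + w'²` stays between two positive constants. -/
theorem IsWolffProfile.exists_radiusSq_bounds (hp : 1 < p) (hw : IsWolffProfile p w) :
    ∃ m M : ℝ, 0 < m ∧ ∀ s, m ≤ radiusSq w s ∧ radiusSq w s ≤ M := by
  set κ := (2 - p) / (p - 1)
  have hc (s : ℝ) : firstIntegral p w s = firstIntegral p w 0 :=
    is_const_of_deriv_eq_zero (fun s => (hw.hasDerivAt_firstIntegral hp s).differentiableAt)
      (fun s => (hw.hasDerivAt_firstIntegral hp s).deriv) s 0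
  -- The ratio `w'²/R` lies in `[0,1]`, so `log R` differs from the conserved quantity by at most
  -- `|κ|`.
  have hb (s : ℝ) : |Real.log (radiusSq w s) - firstIntegral p w 0| ≤ |κ| := by
    have hR := hw.radiusSq_pos hp s
    rw [← hc s, firstIntegral, sub_add_cancel_left, abs_neg, abs_mul]
    refine mul_le_of_le_one_right (abs_nonneg _) ?_
    rw [abs_of_nonneg (by positivity), div_le_one hR, radiusSq]
    nlinarith [sq_nonneg (w s)]
  refine ⟨Real.exp (firstIntegral p w 0 - |κ|), Real.exp (firstIntegral p w 0 + |κ|),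
    Real.exp_pos _, fun s => ?_⟩
  have hR := hw.radiusSq_pos hp s
  have := abs_le.1 (hb s)
  rw [← Real.le_log_iff_exp_le hR, ← Real.log_le_iff_le_exp hR]
  constructor <;> linarith

theorem IsWolffProfile.contDiff_radiusSq (hw : IsWolffProfile p w) : ContDiff ℝ 1 (radiusSq w) :=
  ((hw.1.of_le (by norm_num)).pow 2).add (hw.contDiff_deriv.pow 2)

/-- The equation of Wolff in divergence form. -/
theorem IsWolffProfile.hasDerivAt_rpow_mul_deriv (hp : 1 < p) (hw : IsWolffProfile p w) (s : ℝ) :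
    HasDerivAt (fun s => radiusSq w s ^ ((p - 2) / 2) * deriv w s)
      (-((p - 1) * (radiusSq w s ^ ((p - 2) / 2) * w s))) s := by
  have hR := hw.radiusSq_pos hp s
  have h := ((hw.hasDerivAt_radiusSq s).rpow_const (p := (p - 2) / 2) (Or.inl hR.ne')).mul
    (hw.hasDerivAt_deriv s)
  refine h.congr_deriv ?_
  have hN := (wolffV_denom_pos hp hR).ne'
  rw [Real.rpow_sub_one hR.ne']
  simp only [radiusSq, wolffV] at hR ⊢
  generalize (w s ^ 2 + deriv w s ^ 2) ^ ((p - 2) / 2) = P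
  generalize w s = a at hR hN ⊢
  generalize deriv w s = b at hR hN ⊢
  have hR' := hR.ne'
  obtain ⟨k, rfl⟩ : ∃ k, p = k + 1 := ⟨p - 1, by ring⟩
  simp only [add_sub_cancel_right] at *
  obtain ⟨N, hNeq⟩ : ∃ N, k * b ^ 2 + a ^ 2 = N := ⟨_, rfl⟩
  rw [hNeq] at hN ⊢
  field_simp
  rw [← hNeq]
  ring

end Profile

/-! ### Geometry of the inclusion -/

section Geometry

variable {d : ℕ} {D : Set (E d)}

/-- The balls `B(x + s e, κ s)`, `0 < s < r`, which fill a truncated cone with vertex `x`, all lie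
in `D`. -/
def HasInteriorCone (D : Set (E d)) (r κ : ℝ) (x : E d) : Prop :=
  ∃ e : E d, ‖e‖ = 1 ∧ ∀ s : ℝ, 0 < s → s < r → Metric.ball (x + s • e) (κ * s) ⊆ D

theorem HasInteriorCone.mono {r κ r' κ' : ℝ} {x : E d} (h : HasInteriorCone D r κ x)
    (hr : r' ≤ r) (hκ : κ' ≤ κ) : HasInteriorCone D r' κ' x := by
  obtain ⟨e, he, H⟩ := h
  exact ⟨e, he, fun s hs hsr => (Metric.ball_subset_ball
    (mul_le_mul_of_nonneg_right hκ hs.le)).trans (H s hs (hsr.trans_le hr))⟩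

/-- Moving by `s e + v` from a boundary point changes the height above the graph by at least `s -
|v| - 2K|v|`, which is positive once `|v| < s/(2K+1)`. -/
theorem HasLipschitzBoundary.exists_interiorCone_nhds (hDlip : HasLipschitzBoundary D) {x₀ : E d}
    (hx₀ : x₀ ∈ frontier D) :
    ∃ r κ : ℝ, 0 < r ∧ 0 < κ ∧ κ ≤ 1 ∧
      ∀ᶠ x in 𝓝 x₀, x ∈ frontier D → HasInteriorCone D r κ x := by
  obtain ⟨e, K, g, he, hg, hev⟩ := hDlip x₀ hx₀
  obtain ⟨δ, hδ, hball⟩ := Metric.eventually_nhds_iff_ball.1 hev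
  have hK : (0 : ℝ) ≤ K := K.2
  have hκ1 : 1 / (2 * (K : ℝ) + 1) ≤ 1 := by
    rw [div_le_one (by positivity)]; linarith
  -- With `|x - x₀| < δ/2`, `s < δ/4` and `|v| < s`, the moved point stays in the ball of radius `δ`
  -- where the graph description is valid.
  refine ⟨δ / 4, 1 / (2 * K + 1), by positivity, by positivity, hκ1, ?_⟩
  filter_upwards [Metric.ball_mem_nhds x₀ (half_pos hδ)] with x hx hxD
  refine ⟨e, he, fun s hs hsr y hy => ?_⟩
  have hxg : g (x - inner ℝ e x • e) ≤ inner ℝ e x := by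
    have hcl : IsClosed {x : E d | g (x - inner ℝ e x • e) ≤ inner ℝ e x} :=
      isClosed_le (hg.continuous.comp (by fun_prop)) (by fun_prop)
    refine closure_minimal ?_ hcl
      (Metric.isOpen_ball.inter_closure (t := D) ⟨Metric.ball_subset_ball (by linarith) hx,
        frontier_subset_closure hxD⟩ : x ∈ closure (Metric.ball x₀ δ ∩ D))
    rintro z ⟨hz, hzD⟩
    exact ((hball z hz).1 hzD).le
  obtain ⟨v, rfl⟩ : ∃ v, y = x + s • e + v := ⟨y - (x + s • e), by abel⟩
  have hv : ‖v‖ < 1 / (2 * K + 1) * s := by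
    simpa [Metric.mem_ball, dist_eq_norm] using hy
  have hvs : ‖v‖ < s := hv.trans_le (mul_le_of_le_one_left hs.le hκ1)
  have hmem : x + s • e + v ∈ Metric.ball x₀ δ := by
    have h1 : ‖s • e‖ = s := by rw [norm_smul, he, Real.norm_of_nonneg hs.le, mul_one]
    have h2 : ‖x - x₀‖ < δ / 2 := by rwa [← dist_eq_norm]
    rw [Metric.mem_ball, dist_eq_norm, show x + s • e + v - x₀ = (x - x₀) + s • e + v by abel]
    have := norm_add₃_le (a := x - x₀) (b := s • e) (c := v)
    linarith
  refine (hball _ hmem).2 ?_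
  have hev : |inner ℝ e v| ≤ ‖v‖ := by simpa [he] using abs_real_inner_le_norm e v
  have hee : inner ℝ e e = (1 : ℝ) := by rw [real_inner_self_eq_norm_sq, he]; norm_num
  have hin : inner ℝ e (x + s • e + v) = inner ℝ e x + s + inner ℝ e v := by
    rw [inner_add_right, inner_add_right, inner_smul_right, hee, mul_one]
  have hdist : g (x + s • e + v - inner ℝ e (x + s • e + v) • e) ≤
      g (x - inner ℝ e x • e) + K * (2 * ‖v‖) := by
    refine (sub_le_iff_le_add'.1 ((le_abs_self _).trans ?_))
    rw [← Real.dist_eq]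
    refine (hg.dist_le_mul _ _).trans (mul_le_mul_of_nonneg_left ?_ hK)
    rw [dist_eq_norm, hin, show x + s • e + v - (inner ℝ e x + s + inner ℝ e v) • e
      - (x - inner ℝ e x • e) = v - inner ℝ e v • e by module]
    refine (norm_sub_le _ _).trans ?_
    rw [norm_smul, he, mul_one, Real.norm_eq_abs]
    linarith
  have hv' : (2 * K + 1) * ‖v‖ < s := by
    have := mul_lt_mul_of_pos_left hv (by positivity : (0 : ℝ) < 2 * K + 1)
    rwa [← mul_assoc, mul_one_div_cancel (by positivity), one_mul] at this
  rw [hin] at hdist ⊢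
  have := (abs_le.1 hev).1
  linarith

/-- The frontier is compact, so finitely many local cone sizes suffice and their minimum serves
everywhere. This uniformity makes the final constants independent of the direction. -/
theorem HasLipschitzBoundary.exists_interiorCone (hDlip : HasLipschitzBoundary D)
    (hDb : Bornology.IsBounded D) :
    ∃ r κ : ℝ, 0 < r ∧ 0 < κ ∧ κ ≤ 1 ∧ ∀ x ∈ frontier D, HasInteriorCone D r κ x := by
  have hcomp : IsCompact (frontier D) :=
    Metric.isCompact_of_isClosed_isBounded isClosed_frontier
      (hDb.closure.subset frontier_subset_closure)
  refine hcomp.induction_on (p := fun S => ∃ r κ : ℝ, 0 < r ∧ 0 < κ ∧ κ ≤ 1 ∧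
    ∀ x ∈ S, HasInteriorCone D r κ x) ?_ ?_ ?_ ?_
  · exact ⟨1, 1, by simp⟩
  · rintro S T hST ⟨r, κ, hr, hκ, hκ1, H⟩
    exact ⟨r, κ, hr, hκ, hκ1, fun x hx => H x (hST hx)⟩
  · rintro S T ⟨r, κ, hr, hκ, hκ1, H⟩ ⟨r', κ', hr', hκ', hκ1', H'⟩
    refine ⟨min r r', min κ κ', lt_min hr hr', lt_min hκ hκ', (min_le_left _ _).trans hκ1, ?_⟩
    rintro x (hx | hx)
    · exact (H x hx).mono (min_le_left _ _) (min_le_left _ _)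
    · exact (H' x hx).mono (min_le_right _ _) (min_le_right _ _)
  · intro x₀ hx₀
    obtain ⟨r, κ, hr, hκ, hκ1, H⟩ := hDlip.exists_interiorCone_nhds hx₀
    exact ⟨{x | x ∈ frontier D → HasInteriorCone D r κ x} ∩ frontier D,
      inter_mem (mem_nhdsWithin_of_mem_nhds H) self_mem_nhdsWithin,
      r, κ, hr, hκ, hκ1, fun x hx => hx.1 hx.2⟩

theorem bddAbove_inner_image (hDb : Bornology.IsBounded D) (ρ : E d) :
    BddAbove ((fun x => inner ℝ ρ x) '' D) := by
  obtain ⟨R, hR⟩ := hDb.exists_norm_le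
  refine ⟨‖ρ‖ * R, ?_⟩
  rintro _ ⟨x, hx, rfl⟩
  exact (real_inner_le_norm ρ x).trans (mul_le_mul_of_nonneg_left (hR x hx) (norm_nonneg _))

theorem inner_le_supportFun (hDb : Bornology.IsBounded D) (ρ : E d) {x : E d} (hx : x ∈ D) :
    inner ℝ ρ x ≤ supportFun D ρ :=
  le_csSup (bddAbove_inner_image hDb ρ) ⟨x, hx, rfl⟩

/-- A maximum over the compact closure cannot occur in the open set, since a small step along `ρ`
would increase the value. -/
theorem exists_frontier_inner_eq_supportFun (hD : IsOpen D) (hDne : D.Nonempty)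
    (hDb : Bornology.IsBounded D) {ρ : E d} (hρ : ‖ρ‖ = 1) :
    ∃ x ∈ frontier D, inner ℝ ρ x = supportFun D ρ := by
  have hcont : Continuous fun x : E d => inner ℝ ρ x := by fun_prop
  obtain ⟨x, hx, hmax⟩ := hDb.isCompact_closure.exists_isMaxOn hDne.closure hcont.continuousOn
  have hle : inner ℝ ρ x ≤ supportFun D ρ :=
    closure_minimal (fun y hy => inner_le_supportFun hDb ρ hy : D ⊆ {y | inner ℝ ρ y ≤ supportFun D ρ})
      (isClosed_le hcont continuous_const) hx
  have hge : supportFun D ρ ≤ inner ℝ ρ x := by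
    refine csSup_le (hDne.image _) ?_
    rintro _ ⟨y, hy, rfl⟩
    exact hmax (subset_closure hy)
  refine ⟨x, ?_, le_antisymm hle hge⟩
  rw [frontier, hD.interior_eq]
  refine ⟨hx, fun hxD => ?_⟩
  obtain ⟨ε, hε, hball⟩ := Metric.isOpen_iff.1 hD x hxD
  have hmem : x + (ε / 2) • ρ ∈ D := by
    refine hball ?_
    rw [Metric.mem_ball, dist_eq_norm, add_sub_cancel_left, norm_smul, hρ, mul_one,
      Real.norm_of_nonneg (half_pos hε).le]
    linarith
  have h1 : inner ℝ ρ (x + (ε / 2) • ρ) ≤ inner ℝ ρ x := hmax (subset_closure hmem)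
  rw [inner_add_right, inner_smul_right, real_inner_self_eq_norm_sq, hρ] at h1
  linarith

/-- The exponential weights `e^{k τ (ρ · x - t)}` are integrable on bounded sets. -/
theorem integrableOn_exp_inner (hDb : Bornology.IsBounded D) (ρ : E d) (k t : ℝ) :
    IntegrableOn (fun x : E d => Real.exp (k * (inner ℝ ρ x - t))) D := by
  have hc : Continuous fun x : E d => Real.exp (k * (inner ℝ ρ x - t)) := by fun_prop
  exact (hc.continuousOn.integrableOn_compact hDb.isCompact_closure).mono_set subset_closure

theorem integral_exp_le (hD : IsOpen D) (hDb : Bornology.IsBounded D) (ρ : E d) {k : ℝ}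
    (hk : 0 ≤ k) (t : ℝ) :
    ∫ x in D, Real.exp (k * (inner ℝ ρ x - t)) ≤
      volume.real D * Real.exp (k * (supportFun D ρ - t)) := by
  have hfin : volume D ≠ ⊤ := hDb.measure_lt_top.ne
  calc _ ≤ ∫ x in D, Real.exp (k * (supportFun D ρ - t)) := by
        refine setIntegral_mono_on (integrableOn_exp_inner hDb ρ k t)
          (integrableOn_const hfin) hD.measurableSet fun x hx => ?_
        have := inner_le_supportFun hDb ρ hx
        gcongr
    _ = _ := by simp

theorem le_integral_exp_of_ball_subset (hDb : Bornology.IsBounded D)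
    {ρ : E d} {k : ℝ} (hk : 0 ≤ k) (t : ℝ) {y : E d} {r l : ℝ} (hsub : Metric.ball y r ⊆ D)
    (hl : ∀ x ∈ Metric.ball y r, l ≤ inner ℝ ρ x) :
    volume.real (Metric.ball y r) * Real.exp (k * (l - t)) ≤
      ∫ x in D, Real.exp (k * (inner ℝ ρ x - t)) := by
  calc _ = ∫ x in Metric.ball y r, Real.exp (k * (l - t)) := by simp
    _ ≤ ∫ x in Metric.ball y r, Real.exp (k * (inner ℝ ρ x - t)) := by
        refine setIntegral_mono_on (integrableOn_const measure_ball_lt_top.ne)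
          ((integrableOn_exp_inner hDb ρ k t).mono_set hsub) measurableSet_ball fun x hx => ?_
        have := hl x hx
        gcongr
    _ ≤ _ := setIntegral_mono_set (integrableOn_exp_inner hDb ρ k t)
        (ae_of_all _ fun x => (Real.exp_pos _).le) hsub.eventuallyLE

/-- The interior cone at a supporting point is used at scale `s = 1/τ`: the ball of radius `κ/τ` has
volume of order `τ^{-d}`, which the factor `τ^d` compensates. -/
theorem exists_le_integral_exp (hD : IsOpen D) (hDne : D.Nonempty) (hDb : Bornology.IsBounded D)
    (hDlip : HasLipschitzBoundary D) {k : ℝ} (hk : 0 < k) :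
    ∃ c τ₀ : ℝ, 0 < c ∧ 0 < τ₀ ∧ ∀ ρ : E d, ‖ρ‖ = 1 → ∀ τ : ℝ, τ₀ ≤ τ →
      c ≤ τ ^ d * ∫ x in D, Real.exp (k * τ * (inner ℝ ρ x - supportFun D ρ)) := by
  obtain ⟨r, κ, hr, hκ, hκ1, H⟩ := hDlip.exists_interiorCone hDb
  have hvol : 0 < volume.real (Metric.ball (0 : E d) κ) :=
    ENNReal.toReal_pos (Metric.measure_ball_pos _ _ hκ).ne' measure_ball_lt_top.ne
  -- On the ball `ρ·x ≥ h - 2/τ`: one `1/τ` is lost in reaching the centre, another (as `κ ≤ 1`)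
  -- inside the ball. Hence the factor `e^{-2k}`. The bound `τ ≥ 2/r` gives `1/τ < r`.
  refine ⟨volume.real (Metric.ball (0 : E d) κ) * Real.exp (-(2 * k)), 2 / r, by positivity,
    by positivity, fun ρ hρ τ hτ => ?_⟩
  have hτ0 : 0 < τ := lt_of_lt_of_le (by positivity) hτ
  obtain ⟨x₁, hx₁, hx₁ρ⟩ := exists_frontier_inner_eq_supportFun hD hDne hDb hρ
  obtain ⟨e, he, hball⟩ := H x₁ hx₁
  have hτr : τ⁻¹ < r := by
    rw [div_le_iff₀ hr] at hτ
    rw [inv_lt_iff_one_lt_mul₀ hτ0]; linarith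
  have key := le_integral_exp_of_ball_subset hDb (ρ := ρ) (mul_nonneg hk.le hτ0.le)
    (supportFun D ρ) (hball τ⁻¹ (inv_pos.2 hτ0) hτr) (l := supportFun D ρ - 2 * τ⁻¹) ?_
  · have hv : volume.real (Metric.ball (x₁ + τ⁻¹ • e) (κ * τ⁻¹))
        = τ⁻¹ ^ d * volume.real (Metric.ball (0 : E d) κ) := by
      rw [mul_comm κ, Measure.real, Measure.addHaar_ball_mul_of_pos _ _ (inv_pos.2 hτ0),
        finrank_euclideanSpace_fin, ENNReal.toReal_mul, ENNReal.toReal_ofReal (by positivity)]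
      rfl
    have h2 : k * τ * (supportFun D ρ - 2 * τ⁻¹ - supportFun D ρ) = -(2 * k) := by
      field_simp; ring
    rw [hv, h2] at key
    have := mul_le_mul_of_nonneg_left key (pow_nonneg hτ0.le d)
    refine le_trans (le_of_eq ?_) this
    rw [← mul_assoc, ← mul_assoc, ← mul_pow, mul_inv_cancel₀ hτ0.ne', one_pow, one_mul]
  · intro x hx
    rw [Metric.mem_ball, dist_eq_norm] at hx
    have h1 : inner ℝ ρ x = inner ℝ ρ x₁ + τ⁻¹ * inner ℝ ρ e
        + inner ℝ ρ (x - (x₁ + τ⁻¹ • e)) := by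
      rw [inner_sub_right, inner_add_right, inner_smul_right]; ring
    have h2 : |inner ℝ ρ e| ≤ 1 := by simpa [he, hρ] using abs_real_inner_le_norm ρ e
    have h3 : |inner ℝ ρ (x - (x₁ + τ⁻¹ • e))| ≤ ‖x - (x₁ + τ⁻¹ • e)‖ := by
      simpa [hρ] using abs_real_inner_le_norm ρ (x - (x₁ + τ⁻¹ • e))
    have h4 := (abs_le.1 h2).1
    have h5 := (abs_le.1 h3).1
    have hi := inv_pos.2 hτ0
    have h6 : κ * τ⁻¹ ≤ τ⁻¹ := mul_le_of_le_one_left hi.le hκ1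
    have h7 : τ⁻¹ * (-1) ≤ τ⁻¹ * inner ℝ ρ e := mul_le_mul_of_nonneg_left h4 hi.le
    rw [h1, hx₁ρ]
    linarith

/-- An open convex hull is the interior of the intersection of its supporting half-spaces. -/
theorem convexHull_eq_interior_halfSpaces (hD : IsOpen D) (hDne : D.Nonempty)
    (hDb : Bornology.IsBounded D) :
    convexHull ℝ D = interior {x : E d | ∀ ρ : E d, ‖ρ‖ = 1 → inner ℝ ρ x ≤ supportFun D ρ} := by
  have hopen : IsOpen (convexHull ℝ D) := hD.convexHull
  have hset : {x : E d | ∀ ρ : E d, ‖ρ‖ = 1 → inner ℝ ρ x ≤ supportFun D ρ}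
      = closure (convexHull ℝ D) := by
    refine Set.Subset.antisymm (fun x hx => ?_) ?_
    · by_contra hxc
      -- The normalized Riesz vector of a separating functional is a direction whose half-space
      -- excludes `x`.
      obtain ⟨f, u, hfu, hux⟩ := geometric_hahn_banach_closed_point
        (convex_convexHull ℝ D).closure isClosed_closure hxc
      obtain ⟨v, rfl⟩ := (InnerProductSpace.toDual ℝ (E d)).surjective f
      simp only [InnerProductSpace.toDual_apply_apply] at hfu hux
      have hv : v ≠ 0 := by
        rintro rfl
        obtain ⟨y, hy⟩ := hDne
        have := hfu y (subset_closure (subset_convexHull ℝ D hy))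
        simp only [inner_zero_left] at this hux
        linarith
      have hvn : 0 < ‖v‖ := norm_pos_iff.2 hv
      have hle := hx (‖v‖⁻¹ • v) (by rw [norm_smul, norm_inv, norm_norm, inv_mul_cancel₀ hvn.ne'])
      have hsup : supportFun D (‖v‖⁻¹ • v) ≤ ‖v‖⁻¹ * u := by
        refine csSup_le (hDne.image _) ?_
        rintro _ ⟨y, hy, rfl⟩
        simp only [real_inner_smul_left]
        exact mul_le_mul_of_nonneg_left
          (hfu y (subset_closure (subset_convexHull ℝ D hy))).le (by positivity)
      rw [real_inner_smul_left] at hle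
      exact absurd (le_of_mul_le_mul_left (hle.trans hsup) (by positivity)) (not_le.2 hux)
    · have hrw : {x : E d | ∀ ρ : E d, ‖ρ‖ = 1 → inner ℝ ρ x ≤ supportFun D ρ}
          = ⋂ (ρ : E d) (_ : ‖ρ‖ = 1), {x | inner ℝ ρ x ≤ supportFun D ρ} := by
        ext; simp
      rw [hrw]
      refine closure_minimal (convexHull_min ?_ ?_) ?_
      · exact fun x hx => Set.mem_iInter₂.2 fun ρ _ => inner_le_supportFun hDb ρ hx
      · exact convex_iInter₂ fun ρ _ => convex_halfSpace_le (innerₛₗ ℝ ρ).isLinear _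
      · exact isClosed_biInter fun ρ _ => isClosed_le (by fun_prop) continuous_const
  -- A convex set with nonempty interior has the same interior as its closure, and this hull is
  -- open.
  rw [hset, (convex_convexHull ℝ D).interior_closure_eq_interior_of_nonempty_interior
    (by rw [hopen.interior_eq]; exact hDne.convexHull), hopen.interior_eq]

/-- The line spanned by `ρ` has a nonzero orthogonal complement because `d ≥ 2`; thus every unit
direction occurs in some orthonormal pair. -/
theorem exists_orthonormal_partner (hd : 2 ≤ d) (ρ : E d) :
    ∃ ρ' : E d, ‖ρ'‖ = 1 ∧ inner ℝ ρ ρ' = 0 := by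
  have hlt : Module.finrank ℝ (Submodule.span ℝ {ρ}) < Module.finrank ℝ (E d) := by
    rw [finrank_euclideanSpace_fin]
    exact (finrank_span_le_card ({ρ} : Set (E d))).trans_lt (by simp; omega)
  obtain ⟨v, hv, hv0⟩ := Submodule.exists_mem_ne_zero_of_ne_bot
    (fun h => hlt.ne (by
      have := Submodule.finrank_add_finrank_orthogonal (Submodule.span ℝ {ρ})
      rwa [h, finrank_bot, add_zero] at this) : (Submodule.span ℝ {ρ})ᗮ ≠ ⊥)
  refine ⟨‖v‖⁻¹ • v, ?_, ?_⟩
  · rw [norm_smul, norm_inv, norm_norm, inv_mul_cancel₀ (norm_ne_zero_iff.2 hv0)]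
  · rw [inner_smul_right, Submodule.mem_orthogonal_singleton_iff_inner_right.1 hv, mul_zero]

end Geometry

/-! ### Sobolev spaces -/

section LpFacts

variable {α F : Type*} {mα : MeasurableSpace α} {μ : Measure α} [NormedAddCommGroup F]
  {p : ℝ} [hp : Fact (1 < p)]

theorem Lp_norm_rpow (G : Lp F (ENNReal.ofReal p) μ) :
    ‖G‖ ^ p = ∫ x, ‖G x‖ ^ p ∂μ := by
  have hp0 : 0 < p := one_pos.trans hp.out
  have h := (Lp.memLp G).eLpNorm_eq_integral_rpow_norm (by simpa using hp0) ENNReal.ofReal_ne_top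
  rw [ENNReal.toReal_ofReal hp0.le] at h
  have hnn : 0 ≤ ∫ x, ‖G x‖ ^ p ∂μ := integral_nonneg fun x => by positivity
  rw [Lp.norm_def, h, ENNReal.toReal_ofReal (by positivity), ← Real.rpow_mul hnn,
    inv_mul_cancel₀ hp0.ne', Real.rpow_one]

theorem integrable_norm_rpow {f : α → F} (hf : MemLp f (ENNReal.ofReal p) μ) :
    Integrable (fun x => ‖f x‖ ^ p) μ := by
  have hp0 : 0 < p := one_pos.trans hp.out
  have := hf.integrable_norm_rpow (by simpa using hp0) ENNReal.ofReal_ne_top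
  rwa [ENNReal.toReal_ofReal hp0.le] at this

theorem holderConjugate_ofReal :
    ENNReal.HolderConjugate (ENNReal.ofReal p) (ENNReal.ofReal p.conjExponent) :=
  (Real.HolderConjugate.conjExponent hp.out).ennrealOfReal

/-- Pairing with an element of the dual Lebesgue space is a continuous functional. -/
theorem exists_clm_integral_inner [InnerProductSpace ℝ F] {k : α → F}
    (hk : MemLp k (ENNReal.ofReal p.conjExponent) μ) :
    ∃ L : Lp F (ENNReal.ofReal p) μ →L[ℝ] ℝ, ∀ G, L G = ∫ x, inner ℝ (G x) (k x) ∂μ := by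
  have := holderConjugate_ofReal (p := p)
  have : Fact (1 ≤ ENNReal.ofReal p.conjExponent) :=
    ⟨ENNReal.one_le_ofReal.2 (Real.HolderConjugate.conjExponent hp.out).symm.lt.le⟩
  refine ⟨((innerSL ℝ (E := F)).lpPairing μ (ENNReal.ofReal p)
    (ENNReal.ofReal p.conjExponent)).flip hk.toLp, fun G => ?_⟩
  rw [ContinuousLinearMap.flip_apply, ContinuousLinearMap.lpPairing_eq_integral]
  refine integral_congr_ae ?_
  filter_upwards [hk.coeFn_toLp] with x hx
  rw [hx, innerSL_apply_apply]

/-- Young's inequality. -/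
theorem young_rpow {p A B : ℝ} (hp : 1 < p) (hA : 0 ≤ A) (hB : 0 ≤ B) :
    p * (A ^ (p - 1) * B) ≤ (p - 1) * A ^ p + B ^ p := by
  have hc := Real.HolderConjugate.conjExponent hp
  have h := Real.young_inequality_of_nonneg (Real.rpow_nonneg hA (p - 1)) hB hc.symm
  have hq : (A ^ (p - 1)) ^ p.conjExponent = A ^ p := by
    rw [← Real.rpow_mul hA]
    congr 1
    rw [Real.conjExponent]
    field_simp [(by linarith : p - 1 ≠ 0)]
  rw [hq] at h
  have := mul_le_mul_of_nonneg_left h (by linarith : 0 ≤ p)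
  refine this.trans (le_of_eq ?_)
  rw [Real.conjExponent]
  have : p - 1 ≠ 0 := by linarith
  field_simp

end LpFacts

/-! ### Completeness, classical gradients and the Poincaré inequality in `W^{1,p}`. -/

section Sobolev

variable {d : ℕ} {Ω : Set (E d)} {p : ℝ} [hp : Fact (1 < p)]

/-- For a fixed test function and direction, both sides of the weak gradient identity are pairings
with functions in the dual Lebesgue space, hence continuous. -/
theorem isClosed_W1p : IsClosed (W1p Ω p : Set (Lp ℝ (ENNReal.ofReal p) (volume.restrict Ω) ×
      Lp (E d) (ENNReal.ofReal p) (volume.restrict Ω))) := by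
  have hset : (W1p Ω p : Set (Lp ℝ (ENNReal.ofReal p) (volume.restrict Ω) ×
      Lp (E d) (ENNReal.ofReal p) (volume.restrict Ω))) =
      ⋂ (φ : E d → ℝ) (_ : IsTestFunction Ω φ) (v : E d), {z |
        ∫ x in Ω, z.1 x * fderiv ℝ φ x v = - ∫ x in Ω, inner ℝ (z.2 x) v * φ x} := by
    ext z
    simp only [Set.mem_iInter, Set.mem_ofPred_eq, SetLike.mem_coe]
    rfl
  rw [hset]
  refine isClosed_iInter fun φ => isClosed_iInter fun hφ => isClosed_iInter fun v => ?_
  have hc : Continuous (fun x => fderiv ℝ φ x v) :=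
    (hφ.1.continuous_fderiv (by simp)).clm_apply continuous_const
  have hs : HasCompactSupport (fun x => fderiv ℝ φ x v) := hφ.2.1.fderiv_apply (𝕜 := ℝ) v
  obtain ⟨L, hL⟩ := exists_clm_integral_inner (p := p) (μ := volume.restrict Ω)
    (hc.memLp_of_hasCompactSupport hs)
  obtain ⟨M, hM⟩ := exists_clm_integral_inner (p := p) (μ := volume.restrict Ω)
    (k := fun x => φ x • v)
    ((hφ.1.continuous.smul continuous_const).memLp_of_hasCompactSupport hφ.2.1.smul_right)
  have h1 (z : Lp ℝ (ENNReal.ofReal p) (volume.restrict Ω)) :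
      ∫ x in Ω, z x * fderiv ℝ φ x v = L z := by
    rw [hL]; simp [mul_comm]
  have h2 (z : Lp (E d) (ENNReal.ofReal p) (volume.restrict Ω)) :
      ∫ x in Ω, inner ℝ (z x) v * φ x = M z := by
    rw [hM]; simp [inner_smul_right, mul_comm]
  simp only [h1, h2]
  exact isClosed_eq (by fun_prop) (by fun_prop)

instance : CompleteSpace (W1p Ω p) := isClosed_W1p.completeSpace_coe

/-- The weak gradient is determined by the function, by the fundamental lemma of the calculus of
variations. So the choice made in `boundaryValueOfFun` is harmless. -/
theorem W1p_ext (hΩ : IsOpen Ω) {u v : W1p Ω p} (h : u.1.1 = v.1.1) : u = v := by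
  rw [← sub_eq_zero]
  set z := u - v
  have hz1 : z.1.1 = 0 := by simp [z, h]
  have hG : ∀ᵐ x ∂(volume.restrict Ω), x ∈ Ω → z.1.2 x = 0 := by
    have hloc : LocallyIntegrable (fun x => z.1.2 x) (volume.restrict Ω) :=
      (Lp.memLp z.1.2).locallyIntegrable Fact.out
    refine hΩ.ae_eq_zero_of_integral_contDiff_smul_eq_zero (hloc.locallyIntegrableOn Ω) ?_
    intro φ h1 h2 h3
    have hφ : IsTestFunction Ω φ := ⟨h1, h2, h3⟩
    refine ext_inner_right ℝ fun v => ?_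
    have hw := z.2 φ hφ v
    have h0 : ∫ x in Ω, z.1.1 x * fderiv ℝ φ x v = 0 := by
      rw [hz1, ← integral_zero (E d) ℝ (μ := volume.restrict Ω)]
      refine integral_congr_ae ?_
      filter_upwards [Lp.coeFn_zero ℝ (ENNReal.ofReal p) (volume.restrict Ω)] with x hx
      rw [hx]; simp
    rw [h0] at hw
    have hint := hloc.integrable_smul_left_of_hasCompactSupport h1.continuous h2
    rw [inner_zero_left, real_inner_comm, ← integral_inner hint v]
    rw [eq_comm, neg_eq_zero] at hw
    rw [← hw]
    refine integral_congr_ae (ae_of_all _ fun x => ?_)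
    simp only [inner_smul_right, real_inner_comm v]
    ring
  have hG' : z.1.2 = 0 := by
    refine Lp.ext ?_
    filter_upwards [hG, ae_restrict_mem hΩ.measurableSet,
      Lp.coeFn_zero (E d) (ENNReal.ofReal p) (volume.restrict Ω)] with x hx hxΩ h0
    rw [hx hxΩ, h0]; rfl
  exact Subtype.ext (Prod.ext hz1 hG')

theorem memLp_of_continuous {F : Type*} [NormedAddCommGroup F] (hΩb : Bornology.IsBounded Ω)
    {f : E d → F} [SecondCountableTopology F] (hf : Continuous f) (q : ENNReal) :
    MemLp f q (volume.restrict Ω) := by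
  have : IsFiniteMeasure (volume.restrict Ω) :=
    ⟨by rw [Measure.restrict_apply_univ]; exact hΩb.measure_lt_top⟩
  have hm : MemLp f ⊤ (volume.restrict Ω) := by
    obtain ⟨C, hC⟩ := hΩb.isCompact_closure.exists_bound_of_continuousOn hf.continuousOn
    have : MemLp f ⊤ (volume.restrict (closure Ω)) :=
      memLp_top_of_bound hf.aestronglyMeasurable C
        ((ae_restrict_iff' isClosed_closure.measurableSet).2 (ae_of_all _ hC))
    exact this.mono_measure (Measure.restrict_mono subset_closure le_rfl)
  exact hm.mono_exponent le_top

theorem isWeakGradient_of_contDiff {u : E d → ℝ} {G : E d → E d} (hu : ContDiff ℝ 1 u)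
    (hG : ∀ x v, fderiv ℝ u x v = inner ℝ (G x) v) : IsWeakGradient Ω u G := by
  intro φ hφ v
  have hdφ : Continuous (fun x => fderiv ℝ φ x v) :=
    (hφ.1.continuous_fderiv (by simp)).clm_apply continuous_const
  have hdφs : HasCompactSupport (fun x => fderiv ℝ φ x v) := hφ.2.1.fderiv_apply (𝕜 := ℝ) v
  have hdu : Continuous (fun x => fderiv ℝ u x v) :=
    (hu.continuous_fderiv (by simp)).clm_apply continuous_const
  have h := integral_mul_fderiv_eq_neg_fderiv_mul_of_integrable (μ := volume) (v := v)
    (f := u) (g := φ)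
    ((hdu.mul hφ.1.continuous).integrable_of_hasCompactSupport hφ.2.1.mul_left)
    ((hu.continuous.mul hdφ).integrable_of_hasCompactSupport hdφs.mul_left)
    ((hu.continuous.mul hφ.1.continuous).integrable_of_hasCompactSupport hφ.2.1.mul_left)
    (fun x _ => hu.differentiable (by simp) x) (fun x _ => hφ.1.differentiable (by simp) x)
  have hz (x) (hx : x ∉ Ω) : φ x = 0 ∧ fderiv ℝ φ x = 0 := by
    have hx' : x ∉ tsupport φ := fun hxs => hx (hφ.2.2 hxs)
    exact ⟨image_eq_zero_of_notMem_tsupport hx',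
      image_eq_zero_of_notMem_tsupport fun hxs => hx' (tsupport_fderiv_subset ℝ hxs)⟩
  rw [setIntegral_eq_integral_of_forall_compl_eq_zero fun x hx => by simp [(hz x hx).2],
    setIntegral_eq_integral_of_forall_compl_eq_zero fun x hx => by simp [(hz x hx).1], h]
  simp only [hG]

/-- A `C¹` function on a bounded set belongs to the Sobolev space, with its classical gradient. -/
theorem exists_W1p_of_contDiff (hΩb : Bornology.IsBounded Ω) {u : E d → ℝ} {G : E d → E d}
    (hu : ContDiff ℝ 1 u) (hGc : Continuous G) (hG : ∀ x v, fderiv ℝ u x v = inner ℝ (G x) v) :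
    ∃ U : W1p Ω p, U.1.1 =ᵐ[volume.restrict Ω] u ∧ U.1.2 =ᵐ[volume.restrict Ω] G := by
  have h1 := memLp_of_continuous hΩb hu.continuous (ENNReal.ofReal p)
  have h2 := memLp_of_continuous hΩb hGc (ENNReal.ofReal p)
  refine ⟨⟨(h1.toLp, h2.toLp), ?_⟩, h1.coeFn_toLp, h2.coeFn_toLp⟩
  intro φ hφ v
  have h := isWeakGradient_of_contDiff hu hG φ hφ v
  rw [show ∫ x in Ω, h1.toLp u x * fderiv ℝ φ x v = ∫ x in Ω, u x * fderiv ℝ φ x v from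
      integral_congr_ae (h1.coeFn_toLp.mono fun x hx => by simp only [hx]),
    show ∫ x in Ω, inner ℝ (h2.toLp G x) v * φ x = ∫ x in Ω, inner ℝ (G x) v * φ x from
      integral_congr_ae (h2.coeFn_toLp.mono fun x hx => by simp only [hx]), h]

theorem gradient_ae_eq_of_contDiff (hΩ : IsOpen Ω) (hΩb : Bornology.IsBounded Ω) {u : E d → ℝ}
    {G : E d → E d} (hu : ContDiff ℝ 1 u) (hGc : Continuous G)
    (hG : ∀ x v, fderiv ℝ u x v = inner ℝ (G x) v) {U : W1p Ω p}
    (hU : U.1.1 =ᵐ[volume.restrict Ω] u) : U.1.2 =ᵐ[volume.restrict Ω] G := by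
  obtain ⟨U', h1, h2⟩ := exists_W1p_of_contDiff (p := p) hΩb hu hGc hG
  rwa [W1p_ext hΩ (Lp.ext (hU.trans h1.symm))]

theorem fderiv_apply_eq_inner_gradient (u : E d → ℝ) (x v : E d) :
    fderiv ℝ u x v = inner ℝ (gradient u x) v := by
  rw [gradient, InnerProductSpace.toDual_symm_apply]

theorem continuous_gradient {u : E d → ℝ} (hu : ContDiff ℝ 1 u) : Continuous (gradient u) :=
  (InnerProductSpace.toDual ℝ (E d)).symm.continuous.comp (hu.continuous_fderiv (by simp))

/-- Integrating by parts against the coordinate `e·x` gives `∫|φ|^p = -∫ (e·x) ∂_e(|φ|^p)`, where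
`|∂_e(|φ|^p)| ≤ p|φ|^{p-1}|∇φ|` and `|e·x| ≤ |R|` on `Ω`. Young's inequality then lets `(p-1)∫|φ|^p`
be absorbed into `p∫|φ|^p`. -/
theorem integral_rpow_le_of_test (hΩb : Bornology.IsBounded Ω) (hd : 0 < d) :
    ∃ C : ℝ, 0 ≤ C ∧ ∀ φ : E d → ℝ, IsTestFunction Ω φ →
      ∫ x, ‖φ x‖ ^ p ≤ C ^ p * ∫ x, ‖fderiv ℝ φ x‖ ^ p := by
  obtain ⟨R, hR⟩ := hΩb.exists_norm_le
  have hp1 : 1 < p := hp.out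
  have hp0 : 0 < p := one_pos.trans hp1
  set e : E d := EuclideanSpace.single ⟨0, hd⟩ 1
  have he : ‖e‖ = 1 := by simp [e]
  refine ⟨p * |R|, by positivity, fun φ hφ => ?_⟩
  set g : E d → ℝ := fun x => ‖φ x‖ ^ p
  have hφ1 : ContDiff ℝ 1 φ := hφ.1.of_le (by exact_mod_cast le_top)
  have hg : ContDiff ℝ 1 g := hφ1.norm_rpow hp1
  have hgs : HasCompactSupport g :=
    hφ.2.1.comp_left (g := fun y : ℝ => ‖y‖ ^ p) (by simp [hp0.ne'])
  have hdg : Continuous (fun x => fderiv ℝ g x e) :=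
    (hg.continuous_fderiv (by simp)).clm_apply continuous_const
  have hdgs : HasCompactSupport (fun x => fderiv ℝ g x e) := hgs.fderiv_apply (𝕜 := ℝ) e
  have hfd (x : E d) : HasFDerivAt (fun x : E d => inner ℝ e x) (innerSL ℝ e) x :=
    (innerSL ℝ e).hasFDerivAt
  have hfdx (x : E d) : fderiv ℝ (fun x : E d => inner ℝ e x) x e = 1 := by
    rw [(hfd x).fderiv, innerSL_apply_apply, real_inner_self_eq_norm_sq, he]; norm_num
  have hcont : Continuous fun x : E d => inner ℝ e x := by fun_prop
  have hgint : Integrable g := hg.continuous.integrable_of_hasCompactSupport hgs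
  have hint2 : Integrable fun x => inner ℝ e x * fderiv ℝ g x e :=
    (hcont.mul hdg).integrable_of_hasCompactSupport hdgs.mul_left
  have hparts := integral_mul_fderiv_eq_neg_fderiv_mul_of_integrable (μ := volume) (v := e)
    (f := fun x : E d => inner ℝ e x) (g := g) (by simpa only [hfdx, one_mul] using hgint) hint2
    ((hcont.mul hg.continuous).integrable_of_hasCompactSupport hgs.mul_left)
    (fun x _ => (hfd x).differentiableAt) (fun x _ => hg.differentiable (by simp) x)
  simp only [hfdx, one_mul] at hparts
  have hB : Integrable fun x => ‖fderiv ℝ φ x‖ ^ p :=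
    ((hφ1.continuous_fderiv (by simp)).norm.rpow_const
      fun _ => Or.inr hp0.le).integrable_of_hasCompactSupport
      ((hφ.2.1.fderiv (𝕜 := ℝ)).comp_left (g := fun y => ‖y‖ ^ p) (by simp [hp0.ne']))
  have hpt (x : E d) : -(p * (inner ℝ e x * fderiv ℝ g x e)) ≤
      (p - 1) * g x + (p * |R|) ^ p * ‖fderiv ℝ φ x‖ ^ p := by
    have hy := young_rpow hp1 (norm_nonneg (φ x))
      (by positivity : 0 ≤ p * |R| * ‖fderiv ℝ φ x‖)
    rw [Real.mul_rpow (by positivity) (norm_nonneg _)] at hy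
    refine le_trans ?_ hy
    rw [← mul_neg]
    refine mul_le_mul_of_nonneg_left ?_ hp0.le
    have h1 : ‖fderiv ℝ g x e‖ ≤ p * ‖φ x‖ ^ (p - 1) * ‖fderiv ℝ φ x‖ := by
      refine ((fderiv ℝ g x).le_opNorm e).trans ?_
      rw [he, mul_one]
      exact norm_fderiv_norm_rpow_le (hφ1.differentiable (by simp)) hp1
    by_cases hx : x ∈ Ω
    · have h2 : |inner ℝ e x| ≤ |R| := by
        have := abs_real_inner_le_norm e x
        rw [he, one_mul] at this
        exact this.trans ((hR x hx).trans (le_abs_self R))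
      calc _ ≤ |inner ℝ e x * fderiv ℝ g x e| := neg_le_abs _
        _ = |inner ℝ e x| * ‖fderiv ℝ g x e‖ := by rw [abs_mul, Real.norm_eq_abs]
        _ ≤ |R| * (p * ‖φ x‖ ^ (p - 1) * ‖fderiv ℝ φ x‖) :=
          mul_le_mul h2 h1 (norm_nonneg _) (abs_nonneg _)
        _ = _ := by ring
    · have h0 : φ x = 0 := image_eq_zero_of_notMem_tsupport fun hxs => hx (hφ.2.2 hxs)
      have hp1' : p - 1 ≠ 0 := by linarith
      rw [h0, norm_zero, Real.zero_rpow hp1', mul_zero, zero_mul, norm_le_zero_iff] at h1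
      rw [h1, h0, norm_zero, Real.zero_rpow hp1']
      simp
  have hmono := integral_mono (hint2.const_mul p).neg
    ((hgint.const_mul (p - 1)).add (hB.const_mul ((p * |R|) ^ p))) hpt
  simp only [Pi.add_apply, Pi.neg_apply] at hmono
  rw [integral_neg, integral_const_mul, hparts, integral_add (hgint.const_mul _) (hB.const_mul _),
    integral_const_mul, integral_const_mul] at hmono
  change ∫ x, g x ≤ _
  linarith

theorem testSubmodule_gradient_ae_eq (hΩ : IsOpen Ω) (hΩb : Bornology.IsBounded Ω) {v : W1p Ω p}
    {φ : E d → ℝ} (hφ : IsTestFunction Ω φ) (hv : v.1.1 =ᵐ[volume.restrict Ω] φ) :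
    v.1.2 =ᵐ[volume.restrict Ω] gradient φ :=
  have hφ1 : ContDiff ℝ 1 φ := hφ.1.of_le (by exact_mod_cast le_top)
  gradient_ae_eq_of_contDiff hΩ hΩb hφ1 (continuous_gradient hφ1)
    (fderiv_apply_eq_inner_gradient φ) hv

/-- The inequality of Poincaré on `W_0^{1,p}`. -/
theorem exists_poincare (hd : 0 < d) (hΩ : IsOpen Ω) (hΩb : Bornology.IsBounded Ω) :
    ∃ C : ℝ, 0 ≤ C ∧ ∀ v ∈ W01p Ω p, ‖v.1.1‖ ≤ C * ‖v.1.2‖ := by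
  obtain ⟨C, hC, hbound⟩ := integral_rpow_le_of_test (p := p) hΩb hd
  have hp0 : 0 < p := one_pos.trans hp.out
  refine ⟨C, hC, fun v hv => ?_⟩
  have hcl : IsClosed {v : W1p Ω p | ‖v.1.1‖ ≤ C * ‖v.1.2‖} :=
    isClosed_le (by fun_prop) (by fun_prop)
  refine closure_minimal ?_ hcl hv
  rintro v ⟨φ, hφ, hvφ⟩
  have hgrad := testSubmodule_gradient_ae_eq hΩ hΩb hφ hvφ
  have hz (x) (hx : x ∉ Ω) : φ x = 0 ∧ fderiv ℝ φ x = 0 := by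
    have hx' : x ∉ tsupport φ := fun hxs => hx (hφ.2.2 hxs)
    exact ⟨image_eq_zero_of_notMem_tsupport hx',
      image_eq_zero_of_notMem_tsupport fun hxs => hx' (tsupport_fderiv_subset ℝ hxs)⟩
  rw [Set.mem_ofPred_eq, ← Real.rpow_le_rpow_iff (norm_nonneg _) (by positivity) hp0,
    Real.mul_rpow hC (norm_nonneg _), Lp_norm_rpow, Lp_norm_rpow]
  have h1 : ∫ x in Ω, ‖v.1.1 x‖ ^ p = ∫ x, ‖φ x‖ ^ p := by
    rw [← setIntegral_eq_integral_of_forall_compl_eq_zero (s := Ω) (f := fun x => ‖φ x‖ ^ p)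
      fun x hx => by simp [(hz x hx).1, hp0.ne']]
    exact integral_congr_ae (hvφ.mono fun x hx => by simp only [hx])
  have h2 : ∫ x in Ω, ‖v.1.2 x‖ ^ p = ∫ x, ‖fderiv ℝ φ x‖ ^ p := by
    rw [← setIntegral_eq_integral_of_forall_compl_eq_zero (s := Ω) (f := fun x => ‖fderiv ℝ φ x‖ ^ p)
      fun x hx => by simp [(hz x hx).2, hp0.ne']]
    refine integral_congr_ae (hgrad.mono fun x hx => ?_)
    simp only [hx, gradient, LinearIsometryEquiv.norm_map]
  rw [h1, h2]
  exact hbound φ hφ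

end Sobolev

/-! ### Minimizers of the weighted energy -/

section Pointwise

variable {p : ℝ}

theorem rpow_sub_two_mul_norm {V : Type*} [NormedAddCommGroup V] (hp : 1 < p) (a : V) : ‖a‖ ^ (p - 2) * ‖a‖ = ‖a‖ ^ (p - 1) := by
  rcases eq_or_ne a 0 with rfl | ha
  · simp [Real.zero_rpow (by linarith : p - 1 ≠ 0)]
  · rw [← Real.rpow_add_one (norm_ne_zero_iff.2 ha)]; ring_nf

theorem rpow_sub_one_mul_norm {V : Type*} [NormedAddCommGroup V] (hp : 1 < p) (a : V) : ‖a‖ ^ (p - 1) * ‖a‖ = ‖a‖ ^ p := by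
  rcases eq_or_ne a 0 with rfl | ha
  · simp [Real.zero_rpow (by linarith : p ≠ 0)]
  · rw [← Real.rpow_add_one (norm_ne_zero_iff.2 ha)]; ring_nf

variable {V : Type*} [NormedAddCommGroup V] [InnerProductSpace ℝ V]

theorem rpow_sub_two_mul_inner_self (hp : 1 < p) (a : V) :
    ‖a‖ ^ (p - 2) * inner ℝ a a = ‖a‖ ^ p := by
  rw [real_inner_self_eq_norm_sq, sq, ← mul_assoc, rpow_sub_two_mul_norm hp,
    rpow_sub_one_mul_norm hp]

theorem abs_rpow_sub_two_mul_inner_le (hp : 1 < p) (a c : V) :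
    |‖a‖ ^ (p - 2) * inner ℝ a c| ≤ ‖a‖ ^ (p - 1) * ‖c‖ := by
  rw [abs_mul, abs_of_nonneg (by positivity), ← rpow_sub_two_mul_norm hp, mul_assoc]
  exact mul_le_mul_of_nonneg_left (abs_real_inner_le_norm a c) (by positivity)

/-- For `p < 2` the first factor is singular at `0`. The product is nevertheless `1/p` times a
directional derivative of the `C¹` function `‖·‖^p`. -/
theorem continuous_rpow_sub_two_mul_inner (hp : 1 < p) (c : V) :
    Continuous fun a : V => ‖a‖ ^ (p - 2) * inner ℝ a c := by
  have h : Continuous fun a : V => fderiv ℝ (fun x : V => ‖x‖ ^ p) a c :=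
    ((contDiff_norm_rpow hp).continuous_fderiv (by simp)).clm_apply continuous_const
  have hp0 : p ≠ 0 := by linarith
  have heq : (fun a : V => ‖a‖ ^ (p - 2) * inner ℝ a c)
      = fun a => p⁻¹ * fderiv ℝ (fun x : V => ‖x‖ ^ p) a c := by
    ext a
    rw [fderiv_norm_rpow a hp]
    simp [innerSL_apply_apply]
    field_simp
  rw [heq]
  exact continuous_const.mul h

/-- A weighted form of the subgradient inequality for `‖·‖ ^ p`. -/
theorem weighted_young (hp : 1 < p) {s : ℝ} (hs : 0 < s) (a b : V) :
    p * (‖a‖ ^ (p - 2) * inner ℝ a b) ≤ (p - 1) * (s ^ (-(1 / (p - 1))) * ‖a‖ ^ p) + s * ‖b‖ ^ p := by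
  have hp1 : p - 1 ≠ 0 := by linarith
  have hp0 : p ≠ 0 := by linarith
  -- The exponents are chosen so that `s` cancels in `A^{p-1} B` while `B^p` carries exactly `s`.
  have h := young_rpow hp (A := s ^ (-(1 / (p * (p - 1)))) * ‖a‖) (B := s ^ (1 / p) * ‖b‖)
    (by positivity) (by positivity)
  have h1 : (s ^ (-(1 / (p * (p - 1)))) * ‖a‖) ^ (p - 1) = s ^ (-(1 / p)) * ‖a‖ ^ (p - 1) := by
    rw [Real.mul_rpow (by positivity) (norm_nonneg _), ← Real.rpow_mul hs.le]
    congr 2; field_simp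
  have h2 : (s ^ (-(1 / (p * (p - 1)))) * ‖a‖) ^ p = s ^ (-(1 / (p - 1))) * ‖a‖ ^ p := by
    rw [Real.mul_rpow (by positivity) (norm_nonneg _), ← Real.rpow_mul hs.le]
    congr 2; field_simp
  have h3 : (s ^ (1 / p) * ‖b‖) ^ p = s * ‖b‖ ^ p := by
    rw [Real.mul_rpow (by positivity) (norm_nonneg _), ← Real.rpow_mul hs.le,
      one_div_mul_cancel hp0, Real.rpow_one]
  have h4 : s ^ (-(1 / p)) * ‖a‖ ^ (p - 1) * (s ^ (1 / p) * ‖b‖) = ‖a‖ ^ (p - 1) * ‖b‖ := by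
    have : s ^ (-(1 / p)) * s ^ (1 / p) = 1 := by
      rw [← Real.rpow_add hs, neg_add_cancel, Real.rpow_zero]
    linear_combination (‖a‖ ^ (p - 1) * ‖b‖) * this
  rw [h1, h2, h3, h4] at h
  refine le_trans (mul_le_mul_of_nonneg_left ?_ (by linarith)) h
  exact (le_abs_self _).trans (abs_rpow_sub_two_mul_inner_le hp a b)

theorem norm_rpow_subgradient (hp : 1 < p) (a b : V) :
    ‖a‖ ^ p + p * (‖a‖ ^ (p - 2) * inner ℝ a (b - a)) ≤ ‖b‖ ^ p := by
  have h := weighted_young hp one_pos a b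
  rw [Real.one_rpow, one_mul, one_mul] at h
  rw [inner_sub_right, mul_sub, rpow_sub_two_mul_inner_self hp]
  linarith

/-- For equal norms the strictness comes from the strict convexity of the Euclidean norm, for
different norms from that of `r ↦ r^p`. -/
theorem norm_midpoint_rpow_lt (hp : 1 < p) {a b : V} (hab : a ≠ b) :
    ‖(1 / 2 : ℝ) • (a + b)‖ ^ p < (‖a‖ ^ p + ‖b‖ ^ p) / 2 := by
  have hp0 : 0 < p := by linarith
  by_cases h : ‖a‖ = ‖b‖
  · have := Real.rpow_lt_rpow (norm_nonneg _) ((norm_midpoint_lt_iff h).2 hab) hp0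
    rw [← h]
    linarith
  · have h1 : ‖(1 / 2 : ℝ) • (a + b)‖ ≤ (1 / 2) * ‖a‖ + (1 / 2) * ‖b‖ := by
      rw [norm_smul, Real.norm_of_nonneg (by norm_num : (0 : ℝ) ≤ 1 / 2)]
      linarith [norm_add_le a b]
    have h2 := (strictConvexOn_rpow hp).2 (Set.mem_Ici.2 (norm_nonneg a))
      (Set.mem_Ici.2 (norm_nonneg b)) h (by norm_num : (0 : ℝ) < 1 / 2)
      (by norm_num : (0 : ℝ) < 1 / 2) (by norm_num)
    simp only [smul_eq_mul] at h2
    have h3 := Real.rpow_le_rpow (norm_nonneg _) h1 hp0.le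
    linarith

/-- Quantitative strict convexity of `‖·‖ ^ p`. -/
theorem exists_norm_sub_rpow_le [FiniteDimensional ℝ V] (hp : 1 < p) {ε : ℝ} (hε : 0 < ε) :
    ∃ C : ℝ, 0 ≤ C ∧ ∀ a b : V, ‖a - b‖ ^ p ≤ ε * (‖a‖ ^ p + ‖b‖ ^ p) +
      C * ((‖a‖ ^ p + ‖b‖ ^ p) / 2 - ‖(1 / 2 : ℝ) • (a + b)‖ ^ p) := by
  have hp0 : 0 < p := by linarith
  have hc {f : V × V → V} (hf : Continuous f) : Continuous fun z => ‖f z‖ ^ p :=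
    hf.norm.rpow_const fun _ => Or.inr hp0.le
  set gap : V × V → ℝ := fun z => (‖z.1‖ ^ p + ‖z.2‖ ^ p) / 2 - ‖(1 / 2 : ℝ) • (z.1 + z.2)‖ ^ p
  have hgap : Continuous gap :=
    (((hc continuous_fst).add (hc continuous_snd)).div_const 2).sub (hc (by fun_prop))
  have hgap0 (z : V × V) : 0 ≤ gap z := by
    obtain ⟨a, b⟩ := z
    rcases eq_or_ne a b with rfl | h
    · have : (1 / 2 : ℝ) • (a + a) = a := by module
      simp only [gap, this]
      linarith
    · exact (sub_pos.2 (norm_midpoint_rpow_lt hp h)).le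
  -- On the unit sphere the `ε` term suffices outside `K`. The compact set `K` avoids the diagonal,
  -- so the convexity gap has a positive minimum there. Homogeneity of degree `p` extends the
  -- estimate to all pairs.
  set K : Set (V × V) := Metric.sphere 0 1 ∩
    {z | ε * (‖z.1‖ ^ p + ‖z.2‖ ^ p) ≤ ‖z.1 - z.2‖ ^ p}
  have hK : IsCompact K := (isCompact_sphere _ _).inter_right
    (isClosed_le (continuous_const.mul ((hc continuous_fst).add (hc continuous_snd)))
      (hc (by fun_prop)))
  have hmain : ∃ C : ℝ, 0 ≤ C ∧ ∀ z ∈ K, ‖z.1 - z.2‖ ^ p ≤ C * gap z := by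
    rcases K.eq_empty_or_nonempty with hKe | hKne
    · exact ⟨0, le_rfl, by simp [hKe]⟩
    obtain ⟨z₀, hz₀, hmin⟩ := hK.exists_isMinOn hKne hgap.continuousOn
    have hpos : 0 < gap z₀ := by
      refine sub_pos.2 (norm_midpoint_rpow_lt hp fun h => ?_)
      have h1 : ε * (‖z₀.1‖ ^ p + ‖z₀.2‖ ^ p) ≤ ‖z₀.1 - z₀.2‖ ^ p := hz₀.2
      rw [h, sub_self, norm_zero, Real.zero_rpow hp0.ne'] at h1
      have h2 : ‖z₀.2‖ ^ p = 0 := by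
        have : 0 ≤ ‖z₀.2‖ ^ p := by positivity
        nlinarith
      have h3 : z₀.2 = 0 := by
        rwa [Real.rpow_eq_zero (norm_nonneg _) hp0.ne', norm_eq_zero] at h2
      have h4 : ‖z₀‖ = 1 := by simpa using hz₀.1
      rw [Prod.norm_def, h, h3] at h4
      simp at h4
    refine ⟨2 ^ p / gap z₀, by positivity, fun z hz => ?_⟩
    have hz1 : ‖z‖ = 1 := by simpa using hz.1
    have h1 : ‖z.1 - z.2‖ ≤ 2 := by
      have := norm_sub_le z.1 z.2
      have := norm_fst_le z
      have := norm_snd_le z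
      linarith
    calc ‖z.1 - z.2‖ ^ p ≤ 2 ^ p := Real.rpow_le_rpow (norm_nonneg _) h1 hp0.le
      _ = 2 ^ p / gap z₀ * gap z₀ := (div_mul_cancel₀ _ hpos.ne').symm
      _ ≤ _ := mul_le_mul_of_nonneg_left (hmin hz) (by positivity)
  obtain ⟨C, hC, hCK⟩ := hmain
  refine ⟨C, hC, fun a b => ?_⟩
  have hsphere (z : V × V) (hz : ‖z‖ = 1) :
      ‖z.1 - z.2‖ ^ p ≤ ε * (‖z.1‖ ^ p + ‖z.2‖ ^ p) + C * gap z := by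
    by_cases hzK : ε * (‖z.1‖ ^ p + ‖z.2‖ ^ p) ≤ ‖z.1 - z.2‖ ^ p
    · have h1 := hCK z ⟨by simpa using hz, hzK⟩
      have : 0 ≤ ε * (‖z.1‖ ^ p + ‖z.2‖ ^ p) := by positivity
      linarith
    · have := mul_nonneg hC (hgap0 z)
      linarith [not_le.1 hzK]
  rcases eq_or_ne ((a, b) : V × V) 0 with h0 | h0
  · obtain ⟨rfl, rfl⟩ := Prod.mk_eq_zero.1 h0
    simp [Real.zero_rpow hp0.ne']
  set r := ‖((a, b) : V × V)‖
  have hr : 0 < r := norm_pos_iff.2 h0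
  have h := hsphere (r⁻¹ • (a, b)) (by
    rw [norm_smul, norm_inv, Real.norm_of_nonneg hr.le, inv_mul_cancel₀ hr.ne'])
  have hscale (c : V) : ‖r⁻¹ • c‖ ^ p = r⁻¹ ^ p * ‖c‖ ^ p := by
    rw [norm_smul, Real.norm_of_nonneg (inv_nonneg.2 hr.le),
      Real.mul_rpow (inv_nonneg.2 hr.le) (norm_nonneg _)]
  have hr' : 0 < r⁻¹ ^ p := by positivity
  have e1 : (1 / 2 : ℝ) • (r⁻¹ • a + r⁻¹ • b) = r⁻¹ • ((1 / 2 : ℝ) • (a + b)) := by module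
  simp only [gap, Prod.smul_fst, Prod.smul_snd, ← smul_sub, e1, hscale] at h
  refine le_of_mul_le_mul_left (h.trans (le_of_eq ?_)) hr'
  ring

end Pointwise

/-! ### The direct method, the Euler–Lagrange equation and the Dirichlet to Neumann map. -/

section Energy

variable {d : ℕ} {Ω : Set (E d)} {p : ℝ} [hp : Fact (1 < p)] {σ : E d → ℝ} {a b : ℝ}

/-- A measurable coefficient on `Ω` with values between positive constants `a` and `b`. -/
structure IsConductivity (Ω : Set (E d)) (σ : E d → ℝ) (a b : ℝ) : Prop where
  aemeasurable : AEMeasurable σ (volume.restrict Ω)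
  pos : 0 < a
  bounds : ∀ᵐ x ∂(volume.restrict Ω), a ≤ σ x ∧ σ x ≤ b

theorem IsConductivity.abs_le (hσ : IsConductivity Ω σ a b) :
    ∀ᵐ x ∂(volume.restrict Ω), ‖σ x‖ ≤ b :=
  hσ.bounds.mono fun x hx => by
    rw [Real.norm_of_nonneg (hσ.pos.le.trans hx.1)]; exact hx.2

theorem IsConductivity.integrable_mul (hσ : IsConductivity Ω σ a b) {g : E d → ℝ}
    (hg : Integrable g (volume.restrict Ω)) :
    Integrable (fun x => σ x * g x) (volume.restrict Ω) :=
  hg.bdd_mul hσ.aemeasurable.aestronglyMeasurable hσ.abs_le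

theorem IsConductivity.integrable_energy (hσ : IsConductivity Ω σ a b)
    (G : Lp (E d) (ENNReal.ofReal p) (volume.restrict Ω)) :
    Integrable (fun x => σ x * ‖G x‖ ^ p) (volume.restrict Ω) :=
  hσ.integrable_mul (integrable_norm_rpow (Lp.memLp G))

theorem aestronglyMeasurable_rpow_smul {p : ℝ}
    (G : Lp (E d) (ENNReal.ofReal p) (volume.restrict Ω)) :
    AEStronglyMeasurable (fun x => ‖G x‖ ^ (p - 2) • G x) (volume.restrict Ω) :=
  ((Lp.aestronglyMeasurable G).norm.aemeasurable.pow_const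
    (p - 2)).aestronglyMeasurable.smul (Lp.aestronglyMeasurable G)

theorem IsConductivity.memLp_flux (hσ : IsConductivity Ω σ a b)
    (G : Lp (E d) (ENNReal.ofReal p) (volume.restrict Ω)) :
    MemLp (fun x => σ x • ‖G x‖ ^ (p - 2) • G x) (ENNReal.ofReal p.conjExponent)
      (volume.restrict Ω) := by
  have hp1 : 0 < p - 1 := sub_pos.2 hp.out
  have h := (Lp.memLp G).norm_rpow_div (ENNReal.ofReal (p - 1))
  rw [ENNReal.toReal_ofReal hp1.le, ← ENNReal.ofReal_div_of_pos hp1] at h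
  refine MemLp.of_le_mul (c := b) h (hσ.aemeasurable.aestronglyMeasurable.smul
    (aestronglyMeasurable_rpow_smul G)) ?_
  filter_upwards [hσ.abs_le] with x hx
  rw [norm_smul, norm_smul, Real.norm_of_nonneg (by positivity : 0 ≤ ‖G x‖ ^ (p - 2)),
    rpow_sub_two_mul_norm hp.out, Real.norm_of_nonneg (by positivity : 0 ≤ ‖G x‖ ^ (p - 1))]
  exact mul_le_mul_of_nonneg_right hx (by positivity)

/-- The flux of `u` is a continuous linear functional. -/
theorem IsConductivity.exists_clm_flux (hσ : IsConductivity Ω σ a b) (u : W1p Ω p) :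
    ∃ L : W1p Ω p →L[ℝ] ℝ, ∀ g, L g = flux Ω p σ u g := by
  obtain ⟨L, hL⟩ := exists_clm_integral_inner (hσ.memLp_flux u.1.2)
  refine ⟨L.comp ((ContinuousLinearMap.snd ℝ _ _).comp (W1p Ω p).subtypeL), fun g => ?_⟩
  simp only [ContinuousLinearMap.comp_apply, Submodule.subtypeL_apply,
    ContinuousLinearMap.coe_snd', hL, flux]
  refine integral_congr_ae (ae_of_all _ fun x => ?_)
  simp only [inner_smul_right, real_inner_comm (g.1.2 x)]
  ring

theorem IsConductivity.integrable_flux (hσ : IsConductivity Ω σ a b)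
    (G H : Lp (E d) (ENNReal.ofReal p) (volume.restrict Ω)) :
    Integrable (fun x => σ x * (‖G x‖ ^ (p - 2) * inner ℝ (G x) (H x))) (volume.restrict Ω) := by
  have := holderConjugate_ofReal (p := p)
  have h := (innerSL ℝ (E := E d)).memLp_of_bilin 1 (Lp.memLp H) (hσ.memLp_flux G)
  refine (memLp_one_iff_integrable.1 h).congr (ae_of_all _ fun x => ?_)
  change inner ℝ (H x) (σ x • ‖G x‖ ^ (p - 2) • G x) = _
  rw [inner_smul_right, inner_smul_right, real_inner_comm]

theorem flux_self (u : W1p Ω p) : flux Ω p σ u u = energy Ω p σ u := by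
  refine integral_congr_ae (ae_of_all _ fun x => ?_)
  simp only [mul_assoc, rpow_sub_two_mul_inner_self hp.out]

theorem IsConductivity.flux_sub (hσ : IsConductivity Ω σ a b) (u g h : W1p Ω p) :
    flux Ω p σ u (g - h) = flux Ω p σ u g - flux Ω p σ u h := by
  obtain ⟨L, hL⟩ := hσ.exists_clm_flux u
  rw [← hL, ← hL, ← hL, map_sub]

theorem IsConductivity.flux_smul (hσ : IsConductivity Ω σ a b) (u g : W1p Ω p) (c : ℝ) :
    flux Ω p σ u (c • g) = c * flux Ω p σ u g := by
  obtain ⟨L, hL⟩ := hσ.exists_clm_flux u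
  rw [← hL, ← hL, map_smul, smul_eq_mul]

theorem gradient_sub_ae (u v : W1p Ω p) :
    ∀ᵐ x ∂(volume.restrict Ω), (u - v).1.2 x = u.1.2 x - v.1.2 x :=
  Lp.coeFn_sub u.1.2 v.1.2

theorem gradient_add_ae (u v : W1p Ω p) :
    ∀ᵐ x ∂(volume.restrict Ω), (u + v).1.2 x = u.1.2 x + v.1.2 x :=
  Lp.coeFn_add u.1.2 v.1.2

theorem gradient_smul_ae (c : ℝ) (u : W1p Ω p) :
    ∀ᵐ x ∂(volume.restrict Ω), (c • u).1.2 x = c • u.1.2 x :=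
  Lp.coeFn_smul c u.1.2

/-- Convexity of `‖·‖^p`, integrated. It supplies lower semicontinuity of the energy, the
Euler–Lagrange equation, and the fact that weak solutions are minimizers. -/
theorem IsConductivity.energy_subgradient (hσ : IsConductivity Ω σ a b) (u v : W1p Ω p) :
    energy Ω p σ u + p * flux Ω p σ u (v - u) ≤ energy Ω p σ v := by
  have h1 := hσ.integrable_energy u.1.2
  have h2 := (hσ.integrable_flux u.1.2 (v - u).1.2).const_mul p
  have h3 : p * flux Ω p σ u (v - u) = ∫ x in Ω,
      p * (σ x * (‖u.1.2 x‖ ^ (p - 2) * inner ℝ (u.1.2 x) ((v - u).1.2 x))) := by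
    rw [integral_const_mul, flux]; simp only [mul_assoc]
  rw [h3, energy, ← integral_add h1 h2]
  refine integral_mono_ae (h1.add h2) (hσ.integrable_energy v.1.2) ?_
  filter_upwards [hσ.bounds, gradient_sub_ae v u] with x hx hs
  have h := mul_le_mul_of_nonneg_left (norm_rpow_subgradient hp.out (u.1.2 x) (v.1.2 x))
    (hσ.pos.le.trans hx.1)
  rw [hs]
  linarith

theorem energy_nonneg (hσ : IsConductivity Ω σ a b) (u : W1p Ω p) : 0 ≤ energy Ω p σ u :=
  integral_nonneg_of_ae (hσ.bounds.mono fun x hx =>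
    mul_nonneg (hσ.pos.le.trans hx.1) (by positivity))

theorem integral_gap {α : Type*} {mα : MeasurableSpace α} {μ : Measure α} {f g h : α → ℝ}
    (hf : Integrable f μ) (hg : Integrable g μ) (hh : Integrable h μ) (ε C : ℝ) :
    Integrable (fun x => ε * (f x + g x) + C * ((f x + g x) / 2 - h x)) μ ∧
    ∫ x, (ε * (f x + g x) + C * ((f x + g x) / 2 - h x)) ∂μ =
      ε * (∫ x, f x ∂μ + ∫ x, g x ∂μ) +
        C * ((∫ x, f x ∂μ + ∫ x, g x ∂μ) / 2 - ∫ x, h x ∂μ) := by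
  have h1 : Integrable (fun x => f x + g x) μ := hf.add hg
  have h2 : Integrable (fun x => (f x + g x) / 2) μ := h1.div_const 2
  have h3 : Integrable (fun x => (f x + g x) / 2 - h x) μ := h2.sub hh
  refine ⟨(h1.const_mul ε).add (h3.const_mul C), ?_⟩
  rw [integral_add (h1.const_mul ε) (h3.const_mul C), integral_const_mul, integral_const_mul,
    integral_sub h2 hh, integral_div, integral_add hf hg]

theorem gap_pointwise {V : Type*} [NormedAddCommGroup V] [NormedSpace ℝ V]
    {A B S M : V} {p ε C a s : ℝ}
    (h : ‖A - B‖ ^ p ≤ ε * (‖A‖ ^ p + ‖B‖ ^ p) +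
      C * ((‖A‖ ^ p + ‖B‖ ^ p) / 2 - ‖(1 / 2 : ℝ) • (A + B)‖ ^ p))
    (ha : 0 ≤ a) (has : a ≤ s) (hS : S = A - B) (hM : M = (1 / 2 : ℝ) • (A + B)) :
    a * ‖S‖ ^ p ≤ ε * (s * ‖A‖ ^ p + s * ‖B‖ ^ p) +
      C * ((s * ‖A‖ ^ p + s * ‖B‖ ^ p) / 2 - s * ‖M‖ ^ p) := by
  rw [hS, hM]
  have h1 := mul_le_mul_of_nonneg_left h (ha.trans has)
  have h2 : a * ‖A - B‖ ^ p ≤ s * ‖A - B‖ ^ p := mul_le_mul_of_nonneg_right has (by positivity)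
  refine h2.trans (h1.trans (le_of_eq ?_))
  ring

theorem IsConductivity.exists_norm_gradient_sub_le (hσ : IsConductivity Ω σ a b) {ε : ℝ}
    (hε : 0 < ε) : ∃ C : ℝ, 0 ≤ C ∧ ∀ u v : W1p Ω p,
      a * ‖(u - v).1.2‖ ^ p ≤ ε * (energy Ω p σ u + energy Ω p σ v) +
        C * ((energy Ω p σ u + energy Ω p σ v) / 2 - energy Ω p σ ((1 / 2 : ℝ) • (u + v))) := by
  obtain ⟨C, hC, H⟩ := exists_norm_sub_rpow_le (V := E d) hp.out hε
  refine ⟨C, hC, fun u v => ?_⟩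
  obtain ⟨hi, he⟩ := integral_gap (hσ.integrable_energy u.1.2) (hσ.integrable_energy v.1.2)
    (hσ.integrable_energy ((1 / 2 : ℝ) • (u + v)).1.2) ε C
  simp only [energy]
  rw [← he, Lp_norm_rpow, ← integral_const_mul]
  refine integral_mono_ae ((integrable_norm_rpow (Lp.memLp (u - v).1.2)).const_mul a) hi ?_
  filter_upwards [hσ.bounds, gradient_sub_ae u v, gradient_add_ae u v,
    gradient_smul_ae (1 / 2 : ℝ) (u + v)] with x hx hs ha hm
  exact gap_pointwise (H (u.1.2 x) (v.1.2 x)) hσ.pos.le hx.1 hs (hm.trans (congrArg _ ha))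

theorem boundaryValue_eq_iff {u v : W1p Ω p} :
    boundaryValue Ω p u = boundaryValue Ω p v ↔ u - v ∈ W01p Ω p :=
  Submodule.Quotient.eq _

theorem isClosed_W01p : IsClosed (W01p Ω p : Set (W1p Ω p)) :=
  (testSubmodule Ω p).isClosed_topologicalClosure

noncomputable instance : Module ℝ (W1p Ω p) := (W1p Ω p).module

instance : ContinuousSub (W1p Ω p) := inferInstance

/-- Midpoints have energy at least `m`, so the convexity gap of two almost minimizing functions is
small, and by quantitative strict convexity so is the distance of their gradients. -/
theorem IsConductivity.cauchySeq_of_minimizing (hσ : IsConductivity Ω σ a b) {v : ℕ → W1p Ω p}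
    {m K : ℝ} (hm0 : 0 ≤ m) (hK : 0 < K)
    (hmid : ∀ i j, m ≤ energy Ω p σ ((1 / 2 : ℝ) • (v i + v j)))
    (hlim : Tendsto (fun n => energy Ω p σ (v n)) atTop (𝓝 m))
    (hnorm : ∀ i j, ‖v i - v j‖ ≤ K * ‖(v i - v j).1.2‖) : CauchySeq v := by
  have hp0 : 0 < p := one_pos.trans hp.out
  refine Metric.cauchySeq_iff.2 fun δ hδ => ?_
  obtain ⟨δ', hδ', hKδ⟩ : ∃ δ', 0 < δ' ∧ K * δ' = δ :=
    ⟨δ / K, by positivity, mul_div_cancel₀ _ hK.ne'⟩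
  obtain ⟨A, hA, hAeq⟩ : ∃ A, 0 < A ∧ a * δ' ^ p = A :=
    ⟨_, mul_pos hσ.pos (by positivity), rfl⟩
  -- Energies eventually lie below `m + 1`, so this `ε` costs at most `A/2`. Since `C` depends on
  -- `ε`, the tolerance `η` is chosen afterwards, making the gap term at most `A/4`.
  obtain ⟨C, hC, H⟩ := hσ.exists_norm_gradient_sub_le (p := p) (ε := A / (4 * (m + 1)))
    (by positivity)
  obtain ⟨η, hη, hη1, hη2⟩ : ∃ η, 0 < η ∧ η ≤ 1 ∧ C * η ≤ A / 4 := by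
    refine ⟨min 1 (A / (4 * (C + 1))), lt_min one_pos (by positivity), min_le_left _ _, ?_⟩
    have h1 : min 1 (A / (4 * (C + 1))) ≤ A / (4 * (C + 1)) := min_le_right _ _
    have h2 : 0 ≤ min 1 (A / (4 * (C + 1))) := le_min zero_le_one (by positivity)
    rw [le_div_iff₀ (by positivity)] at h1
    linarith
  obtain ⟨N, hN⟩ := eventually_atTop.1 (hlim.eventually_lt_const (lt_add_of_pos_right m hη))
  refine ⟨N, fun i hi j hj => ?_⟩
  have hi' := hN i hi
  have hj' := hN j hj
  have hij := H (v i) (v j)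
  have hm := hmid i j
  rw [dist_eq_norm]
  refine (hnorm i j).trans_lt ?_
  rw [← hKδ]
  refine mul_lt_mul_of_pos_left ?_ hK
  refine (Real.rpow_lt_rpow_iff (norm_nonneg _) hδ'.le hp0).1 (lt_of_mul_lt_mul_left ?_ hσ.pos.le)
  rw [hAeq]
  have h1 : A / (4 * (m + 1)) * (energy Ω p σ (v i) + energy Ω p σ (v j)) ≤ A / 2 := by
    rw [div_mul_eq_mul_div, div_le_iff₀ (by positivity)]
    have : A * (energy Ω p σ (v i) + energy Ω p σ (v j)) ≤ A * (2 * (m + 1)) :=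
      mul_le_mul_of_nonneg_left (by linarith) hA.le
    linarith
  have h2 : C * ((energy Ω p σ (v i) + energy Ω p σ (v j)) / 2 -
      energy Ω p σ ((1 / 2 : ℝ) • (v i + v j))) ≤ C * η :=
    mul_le_mul_of_nonneg_left (by linarith) hC
  linarith

/-- Existence of minimizers, by the direct method. -/
theorem IsConductivity.exists_isMinimizer (hd : 0 < d) (hΩ : IsOpen Ω)
    (hΩb : Bornology.IsBounded Ω) (hσ : IsConductivity Ω σ a b) (f : BoundarySpace Ω p) :
    ∃ u, IsMinimizer Ω p σ f u := by
  obtain ⟨CP, hCP, hpoin⟩ := exists_poincare (p := p) hd hΩ hΩb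
  obtain ⟨u₀, hu₀⟩ : ∃ u₀ : W1p Ω p, boundaryValue Ω p u₀ = f :=
    Submodule.Quotient.mk_surjective _ f
  obtain ⟨T, hT⟩ : ∃ T : Set ℝ, T = energy Ω p σ '' {v | boundaryValue Ω p v = f} := ⟨_, rfl⟩
  have hne : T.Nonempty := hT ▸ ⟨_, u₀, hu₀, rfl⟩
  have hlow : ∀ y ∈ T, 0 ≤ y := by rw [hT]; rintro _ ⟨v, _, rfl⟩; exact energy_nonneg hσ v
  have hbdd : BddBelow T := ⟨0, hlow⟩
  have hm (v : W1p Ω p) (hv : boundaryValue Ω p v = f) : sInf T ≤ energy Ω p σ v :=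
    csInf_le hbdd (hT ▸ ⟨v, hv, rfl⟩)
  obtain ⟨y, -, hy, hyS⟩ := exists_seq_tendsto_sInf hne hbdd
  rw [hT] at hyS
  choose v hvS hvy using hyS
  have hlim : Tendsto (fun n => energy Ω p σ (v n)) atTop (𝓝 (sInf T)) :=
    hy.congr fun n => (hvy n).symm
  have hsub (i j : ℕ) : v i - v j ∈ W01p Ω p :=
    boundaryValue_eq_iff.1 (Eq.trans (hvS i) (Eq.symm (hvS j)))
  have hcauchy : CauchySeq v := by
    refine hσ.cauchySeq_of_minimizing (le_csInf hne hlow) (by positivity : 0 < CP + 1)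
      (fun i j => hm _ ?_) hlim (fun i j => ?_)
    · refine Eq.trans (boundaryValue_eq_iff.2 ?_) (hvS j)
      rw [show (1 / 2 : ℝ) • (v i + v j) - v j = (1 / 2 : ℝ) • (v i - v j) by module]
      exact Submodule.smul_mem _ _ (hsub i j)
    · have h := hpoin _ (hsub i j)
      have h0 := norm_nonneg (v i - v j).1.2
      refine max_le (h.trans ?_) ?_
      · exact mul_le_mul_of_nonneg_right (by linarith) h0
      · exact le_mul_of_one_le_left h0 (by linarith)
  obtain ⟨u, hu⟩ := cauchySeq_tendsto_of_complete hcauchy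
  have hmem : boundaryValue Ω p u = f := by
    refine Eq.trans (boundaryValue_eq_iff.2 ?_) (hvS 0)
    exact isClosed_W01p.mem_of_tendsto (hu.sub_const (v 0))
      (Eventually.of_forall fun n => hsub n 0)
  refine ⟨u, hmem, fun z hz => le_trans ?_ (hm z hz)⟩
  -- The subgradient inequality at the limit `u` bounds the energies of the `v n` below by the
  -- energy of `u` plus a linear term in `v n - u` that tends to zero.
  obtain ⟨L, hL⟩ := hσ.exists_clm_flux u
  have hL0 : Tendsto (fun n => L (v n - u)) atTop (𝓝 0) := by
    have h := (L.continuous.tendsto _).comp (tendsto_sub_nhds_zero_iff.2 hu)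
    rwa [L.map_zero] at h
  have hlim' : Tendsto (fun n => energy Ω p σ u + p * L (v n - u)) atTop (𝓝 (energy Ω p σ u)) := by
    simpa only [mul_zero, add_zero] using (hL0.const_mul p).const_add (energy Ω p σ u)
  refine le_of_tendsto_of_tendsto' hlim' hlim fun n => ?_
  rw [hL]
  exact hσ.energy_subgradient u (v n)

/-- The integrand of the flux in a perturbed field. -/
noncomputable def perturbedFlux (p : ℝ) (σ : E d → ℝ) (G H : E d → E d) (t : ℝ) (x : E d) : ℝ :=
  σ x * (‖G x + t • H x‖ ^ (p - 2) * inner ℝ (G x + t • H x) (H x))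

theorem flux_add_smul_ae (u g : W1p Ω p) (t : ℝ) : ∀ᵐ x ∂(volume.restrict Ω),
    σ x * (‖(u + t • g).1.2 x‖ ^ (p - 2) * inner ℝ ((u + t • g).1.2 x) (g.1.2 x)) =
      perturbedFlux p σ u.1.2 g.1.2 t x := by
  filter_upwards [gradient_add_ae u (t • g), gradient_smul_ae t g] with x h1 h2
  have h := h1.trans (congrArg (u.1.2 x + ·) h2)
  exact congrArg (fun y => σ x * (‖y‖ ^ (p - 2) * inner ℝ y (g.1.2 x))) h

theorem flux_add_smul (u g : W1p Ω p) (t : ℝ) :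
    flux Ω p σ (u + t • g) g = ∫ x in Ω, perturbedFlux p σ u.1.2 g.1.2 t x :=
  integral_congr_ae ((flux_add_smul_ae u g t).mono fun _ hx => (mul_assoc _ _ _).trans hx)

theorem abs_perturbedFlux_le {p : ℝ} (hp : 1 < p) {G H : E d → E d} {t : ℝ} (ht0 : 0 ≤ t) (ht1 : t ≤ 1)
    {x : E d} (hσ : ‖σ x‖ ≤ b) :
    ‖perturbedFlux p σ G H t x‖ ≤ b * ‖‖G x‖ + ‖H x‖‖ ^ p := by
  rw [perturbedFlux, norm_mul]
  refine mul_le_mul hσ ?_ (norm_nonneg _) ((norm_nonneg _).trans hσ)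
  refine (abs_rpow_sub_two_mul_inner_le hp _ _).trans ?_
  have hs : 0 ≤ ‖G x‖ + ‖H x‖ := by positivity
  have h1 : ‖G x + t • H x‖ ≤ ‖G x‖ + ‖H x‖ := by
    refine (norm_add_le _ _).trans (add_le_add_right ?_ _)
    rw [norm_smul, Real.norm_of_nonneg ht0]
    exact mul_le_of_le_one_left (norm_nonneg _) ht1
  have h2 : ‖H x‖ ≤ ‖G x‖ + ‖H x‖ := le_add_of_nonneg_left (norm_nonneg _)
  rw [← rpow_sub_one_mul_norm hp, Real.norm_of_nonneg hs]
  exact mul_le_mul (Real.rpow_le_rpow (norm_nonneg _) h1 (by linarith)) h2 (norm_nonneg _)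
    (by positivity)

/-- Dominated convergence with majorant `b (|∇u| + |∇g|)^p`. It allows the first variation to be
computed without differentiating the energy. -/
theorem IsConductivity.tendsto_flux (hσ : IsConductivity Ω σ a b) (u g : W1p Ω p) :
    Tendsto (fun t : ℝ => flux Ω p σ (u + t • g) g) (𝓝[>] 0) (𝓝 (flux Ω p σ u g)) := by
  have hF0 : flux Ω p σ u g = ∫ x in Ω, perturbedFlux p σ u.1.2 g.1.2 0 x := by
    rw [← flux_add_smul, zero_smul, add_zero]
  rw [hF0]
  refine (tendsto_integral_filter_of_dominated_convergence
    (fun x => b * ‖‖u.1.2 x‖ + ‖g.1.2 x‖‖ ^ p) ?_ ?_ ?_ ?_).congr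
    fun t => (flux_add_smul u g t).symm
  · exact Eventually.of_forall fun t =>
      (hσ.integrable_flux (u + t • g).1.2 g.1.2).aestronglyMeasurable.congr
        (flux_add_smul_ae u g t)
  · filter_upwards [Ioo_mem_nhdsGT (one_pos : (0 : ℝ) < 1)] with t ht
    exact hσ.abs_le.mono fun x hx => abs_perturbedFlux_le hp.out ht.1.le ht.2.le hx
  · exact (integrable_norm_rpow ((Lp.memLp u.1.2).norm.add (Lp.memLp g.1.2).norm)).const_mul b
  · refine ae_of_all _ fun x => ?_
    have hc : Continuous fun t : ℝ => perturbedFlux p σ u.1.2 g.1.2 t x :=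
      continuous_const.mul ((continuous_rpow_sub_two_mul_inner hp.out (g.1.2 x)).comp
        (by fun_prop : Continuous fun t : ℝ => u.1.2 x + t • g.1.2 x))
    exact (hc.tendsto 0).mono_left nhdsWithin_le_nhds

/-- The Euler–Lagrange equation of a minimizer. -/
theorem IsMinimizer.flux_eq_zero (hσ : IsConductivity Ω σ a b) {f : BoundarySpace Ω p}
    {u : W1p Ω p} (hu : IsMinimizer Ω p σ f u) {g : W1p Ω p} (hg : g ∈ W01p Ω p) :
    flux Ω p σ u g = 0 := by
  have hp0 : 0 < p := one_pos.trans hp.out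
  have key (g : W1p Ω p) (hg : g ∈ W01p Ω p) : 0 ≤ flux Ω p σ u g := by
    refine ge_of_tendsto (hσ.tendsto_flux u g) ?_
    filter_upwards [self_mem_nhdsWithin] with t ht
    have ht : 0 < t := ht
    have hmem : boundaryValue Ω p (u + t • g) = f := by
      refine Eq.trans (boundaryValue_eq_iff.2 ?_) hu.1
      rw [add_sub_cancel_left]
      exact Submodule.smul_mem _ _ hg
    have h1 := hu.2 _ hmem
    -- The subgradient is taken at the perturbed point: with minimality it forces the flux of `u + t
    -- g` against `g` to be nonnegative, and then `t → 0`. Applying this to `-g` gives equality.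
    have h2 := hσ.energy_subgradient (u + t • g) u
    rw [show u - (u + t • g) = (-t) • g by module, hσ.flux_smul] at h2
    have h3 : 0 ≤ p * t * flux Ω p σ (u + t • g) g := by linarith
    exact nonneg_of_mul_nonneg_right h3 (by positivity)
  refine le_antisymm ?_ (key g hg)
  have := key ((-1 : ℝ) • g) (Submodule.smul_mem _ _ hg)
  rw [hσ.flux_smul] at this
  linarith

/-- By the Euler–Lagrange equation the flux of a minimizer descends to the quotient, so the
functional sought by `Classical.epsilon` exists. Testing it on the minimizer itself yields the
energy. -/
theorem IsConductivity.dnMap_apply_self (hd : 0 < d) (hΩ : IsOpen Ω)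
    (hΩb : Bornology.IsBounded Ω) (hσ : IsConductivity Ω σ a b) (f : BoundarySpace Ω p) :
    ∃ u, IsMinimizer Ω p σ f u ∧ dnMap Ω p σ f f = energy Ω p σ u := by
  have hex : ∃ L : StrongDual ℝ (BoundarySpace Ω p), ∃ u : W1p Ω p, IsMinimizer Ω p σ f u ∧
      ∀ g : W1p Ω p, L (boundaryValue Ω p g) = flux Ω p σ u g := by
    obtain ⟨u, hu⟩ := hσ.exists_isMinimizer hd hΩ hΩb f
    obtain ⟨L, hL⟩ := hσ.exists_clm_flux u
    refine ⟨(W01p Ω p).liftQL L fun g hg => ?_, u, hu, fun g => hL g⟩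
    exact (hL g).trans (hu.flux_eq_zero hσ hg)
  obtain ⟨u, hu, h⟩ := Classical.epsilon_spec hex
  refine ⟨u, hu, ?_⟩
  exact (congrArg _ hu.1.symm).trans ((h u).trans (flux_self u))

theorem isConductivity_one : IsConductivity Ω (fun _ => (1 : ℝ)) 1 1 :=
  ⟨aemeasurable_const, one_pos, ae_of_all _ fun _ => ⟨le_rfl, le_rfl⟩⟩

theorem isMinimizer_one_of_flux_eq_zero {u : W1p Ω p}
    (hu : ∀ g ∈ W01p Ω p, flux Ω p (fun _ => 1) u g = 0) :
    IsMinimizer Ω p (fun _ => 1) (boundaryValue Ω p u) u := by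
  refine ⟨rfl, fun v hv => ?_⟩
  have h := isConductivity_one.energy_subgradient u v
  rw [hu _ (boundaryValue_eq_iff.1 hv), mul_zero, add_zero] at h
  exact h

end Energy

/-! ### Wolff solutions -/

section Wolff

variable {d : ℕ} {p : ℝ} {w : ℝ → ℝ} {t τ : ℝ} {ρ ρ' : E d}

/-- The rate `k` is kept apart from `τ`: it is `τ` for the Wolff solution and `(p-1)τ` for the
components of its flux. -/
theorem hasFDerivAt_exp_mul (k t τ : ℝ) (ρ ρ' : E d) {α : ℝ → ℝ} {α' : ℝ} (x : E d)
    (hα : HasDerivAt α α' (τ * inner ℝ ρ' x)) :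
    HasFDerivAt (fun x : E d => Real.exp (k * (inner ℝ ρ x - t)) * α (τ * inner ℝ ρ' x))
      (Real.exp (k * (inner ℝ ρ x - t)) •
        ((k * α (τ * inner ℝ ρ' x)) • innerSL ℝ ρ + (τ * α') • innerSL ℝ ρ')) x := by
  have hl (e : E d) : HasFDerivAt (fun x : E d => inner ℝ e x) (innerSL ℝ e) x :=
    (innerSL ℝ e).hasFDerivAt
  have h1 := (((hl ρ).sub_const t).const_mul k).exp
  have h2 := hα.comp_hasFDerivAt x ((hl ρ').const_mul τ)
  refine (h1.mul h2).congr_fderiv ?_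
  ext v
  simp only [add_apply, smul_apply, smul_eq_mul,
    Function.comp]
  ring

theorem contDiff_exp_mul (k t τ : ℝ) (ρ ρ' : E d) {α : ℝ → ℝ} (hα : ContDiff ℝ 1 α) :
    ContDiff ℝ 1 (fun x : E d => Real.exp (k * (inner ℝ ρ x - t)) * α (τ * inner ℝ ρ' x)) := by
  have h (e : E d) : ContDiff ℝ 1 fun x : E d => inner ℝ e x := contDiff_const.inner ℝ contDiff_id
  exact ((contDiff_const.mul ((h ρ).sub contDiff_const)).exp).mul
    (hα.comp (contDiff_const.mul (h ρ')))

/-- The gradient of a Wolff solution. -/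
noncomputable def wolffGradient (w : ℝ → ℝ) (t : ℝ) (ρ ρ' : E d) (τ : ℝ) (x : E d) : E d :=
  (τ * Real.exp (τ * (inner ℝ ρ x - t))) •
    (w (τ * inner ℝ ρ' x) • ρ + deriv w (τ * inner ℝ ρ' x) • ρ')

theorem IsWolffProfile.contDiff_wolffSolution (hw : IsWolffProfile p w) (t τ : ℝ) (ρ ρ' : E d) :
    ContDiff ℝ 1 (wolffSolution w t ρ ρ' τ) :=
  contDiff_exp_mul τ t τ ρ ρ' (hw.1.of_le (by norm_num))

theorem IsWolffProfile.fderiv_wolffSolution (hw : IsWolffProfile p w) (t τ : ℝ) (ρ ρ' : E d)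
    (x v : E d) : fderiv ℝ (wolffSolution w t ρ ρ' τ) x v
      = inner ℝ (wolffGradient w t ρ ρ' τ x) v := by
  have h : fderiv ℝ (wolffSolution w t ρ ρ' τ) x = _ :=
    (hasFDerivAt_exp_mul τ t τ ρ ρ' x (hw.hasDerivAt _)).fderiv
  rw [h, wolffGradient]
  simp only [add_apply, smul_apply, smul_eq_mul,
    innerSL_apply_apply, inner_add_left, real_inner_smul_left]
  ring

theorem IsWolffProfile.continuous_wolffGradient (hw : IsWolffProfile p w) (t τ : ℝ)
    (ρ ρ' : E d) : Continuous (wolffGradient w t ρ ρ' τ) := by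
  have h1 := hw.1.continuous
  have h2 := hw.contDiff_deriv.continuous
  unfold wolffGradient
  fun_prop

theorem norm_wolffGradient (hρ : ‖ρ‖ = 1) (hρ' : ‖ρ'‖ = 1) (hρρ' : inner ℝ ρ ρ' = 0) (hτ : 0 < τ)
    (x : E d) : ‖wolffGradient w t ρ ρ' τ x‖ =
      τ * Real.exp (τ * (inner ℝ ρ x - t)) * radiusSq w (τ * inner ℝ ρ' x) ^ (1 / 2 : ℝ) := by
  rw [wolffGradient, norm_smul, Real.norm_of_nonneg (by positivity), ← Real.sqrt_eq_rpow]
  congr 1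
  rw [← Real.sqrt_sq (norm_nonneg (_ + _ : E d)), radiusSq]
  congr 1
  rw [norm_add_sq_real, norm_smul, norm_smul, hρ, hρ', real_inner_smul_left, real_inner_smul_right,
    hρρ', Real.norm_eq_abs, Real.norm_eq_abs, mul_one, mul_one, sq_abs, sq_abs]
  ring

theorem norm_wolffGradient_rpow (hρ : ‖ρ‖ = 1) (hρ' : ‖ρ'‖ = 1) (hρρ' : inner ℝ ρ ρ' = 0)
    (hτ : 0 < τ) (q : ℝ) (x : E d) : ‖wolffGradient w t ρ ρ' τ x‖ ^ q =
      τ ^ q * Real.exp (q * τ * (inner ℝ ρ x - t)) *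
        radiusSq w (τ * inner ℝ ρ' x) ^ (q / 2) := by
  have hR := radiusSq_nonneg (w := w) (τ * inner ℝ ρ' x)
  rw [norm_wolffGradient hρ hρ' hρρ' hτ, Real.mul_rpow (by positivity) (by positivity),
    Real.mul_rpow hτ.le (Real.exp_pos _).le, ← Real.exp_mul, ← Real.rpow_mul hR,
    show q * τ * (inner ℝ ρ x - t) = τ * (inner ℝ ρ x - t) * q by ring,
    show q / 2 = 1 / 2 * q by ring]

theorem IsWolffProfile.contDiff_rpow_radiusSq (hp : 1 < p) (hw : IsWolffProfile p w) (q : ℝ) :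
    ContDiff ℝ 1 fun s => radiusSq w s ^ q :=
  hw.contDiff_radiusSq.rpow_const_of_ne fun s => (hw.radiusSq_pos hp s).ne'

variable {Ω : Set (E d)}

/-- Wolff solutions are weak solutions of the `p`-Laplace equation. -/
theorem IsWolffProfile.integral_wolffGradient_eq_zero (hp : 1 < p) (hw : IsWolffProfile p w)
    (hρ : ‖ρ‖ = 1) (hρ' : ‖ρ'‖ = 1) (hρρ' : inner ℝ ρ ρ' = 0) (hτ : 0 < τ) {φ : E d → ℝ}
    (hφ : IsTestFunction Ω φ) :
    ∫ x in Ω, ‖wolffGradient w t ρ ρ' τ x‖ ^ (p - 2) *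
      inner ℝ (wolffGradient w t ρ ρ' τ x) (gradient φ x) = 0 := by
  set k := (p - 1) * τ
  set α : ℝ → ℝ := fun s => radiusSq w s ^ ((p - 2) / 2) * w s
  set β : ℝ → ℝ := fun s => radiusSq w s ^ ((p - 2) / 2) * deriv w s
  have hα : ContDiff ℝ 1 α :=
    (hw.contDiff_rpow_radiusSq hp _).mul (hw.1.of_le (by norm_num))
  have hβ : ContDiff ℝ 1 β := (hw.contDiff_rpow_radiusSq hp _).mul hw.contDiff_deriv
  -- The flux field of the Wolff solution is `τ^{p-1}(A ρ + B ρ')`. Its divergence vanishes because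
  -- `β' = -(p-1)α`, the divergence form of the profile equation.
  set A : E d → ℝ := fun x => Real.exp (k * (inner ℝ ρ x - t)) * α (τ * inner ℝ ρ' x)
  set B : E d → ℝ := fun x => Real.exp (k * (inner ℝ ρ x - t)) * β (τ * inner ℝ ρ' x)
  have hA : ContDiff ℝ 1 A := contDiff_exp_mul k t τ ρ ρ' hα
  have hB : ContDiff ℝ 1 B := contDiff_exp_mul k t τ ρ ρ' hβ
  have hself {e : E d} (he : ‖e‖ = 1) : inner ℝ e e = (1 : ℝ) := by
    rw [real_inner_self_eq_norm_sq, he, one_pow]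
  have hdiv (x : E d) : fderiv ℝ A x ρ + fderiv ℝ B x ρ' = 0 := by
    have h1 : fderiv ℝ A x = _ :=
      (hasFDerivAt_exp_mul k t τ ρ ρ' x (hα.differentiable (by simp) _).hasDerivAt).fderiv
    have h2 : fderiv ℝ B x = _ :=
      (hasFDerivAt_exp_mul k t τ ρ ρ' x (hw.hasDerivAt_rpow_mul_deriv hp _)).fderiv
    rw [h1, h2]
    simp only [add_apply, smul_apply, smul_eq_mul,
      innerSL_apply_apply, hself hρ, hself hρ', hρρ', real_inner_comm ρ ρ', k, α]
    ring
  have hpt (x : E d) : ‖wolffGradient w t ρ ρ' τ x‖ ^ (p - 2) *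
      inner ℝ (wolffGradient w t ρ ρ' τ x) (gradient φ x) =
      τ ^ (p - 1) * (A x * fderiv ℝ φ x ρ + B x * fderiv ℝ φ x ρ') := by
    have hexp : Real.exp (k * (inner ℝ ρ x - t)) =
        Real.exp ((p - 2) * τ * (inner ℝ ρ x - t)) * Real.exp (τ * (inner ℝ ρ x - t)) := by
      rw [← Real.exp_add]; congr 1; simp only [k]; ring
    have hτp : τ ^ (p - 1) = τ ^ (p - 2) * τ := by
      rw [← Real.rpow_add_one hτ.ne']; ring_nf
    rw [norm_wolffGradient_rpow hρ hρ' hρρ' hτ]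
    simp only [A, B, α, β, hexp, hτp, wolffGradient, real_inner_smul_right, inner_add_right,
      fderiv_apply_eq_inner_gradient φ x, real_inner_comm (gradient φ x)]
    ring
  have hint {F : E d → ℝ} (hF : ContDiff ℝ 1 F) (v : E d) :
      IntegrableOn (fun x => F x * fderiv ℝ φ x v) Ω := by
    have hc : Continuous (fun x => fderiv ℝ φ x v) :=
      (hφ.1.continuous_fderiv (by simp)).clm_apply continuous_const
    exact ((hF.continuous.mul hc).integrable_of_hasCompactSupport
      (hφ.2.1.fderiv_apply (𝕜 := ℝ) v).mul_left).integrableOn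
  have hint' {F : E d → ℝ} (hF : ContDiff ℝ 1 F) (v : E d) :
      IntegrableOn (fun x => fderiv ℝ F x v * φ x) Ω :=
    ((((hF.continuous_fderiv (by simp)).clm_apply continuous_const).mul
      hφ.1.continuous).integrable_of_hasCompactSupport hφ.2.1.mul_left).integrableOn
  have hparts {F : E d → ℝ} (hF : ContDiff ℝ 1 F) (v : E d) :
      ∫ x in Ω, F x * fderiv ℝ φ x v = -∫ x in Ω, fderiv ℝ F x v * φ x := by
    simpa only [← fderiv_apply_eq_inner_gradient] using
      isWeakGradient_of_contDiff hF (fderiv_apply_eq_inner_gradient F) φ hφ v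
  simp only [hpt]
  rw [integral_const_mul, integral_add (hint hA ρ) (hint hB ρ'), hparts hA, hparts hB, ← neg_add,
    ← integral_add (hint' hA ρ) (hint' hB ρ')]
  simp only [← add_mul, hdiv, zero_mul, integral_zero, neg_zero, mul_zero]

theorem IsWolffProfile.flux_eq_zero [hp : Fact (1 < p)] (hw : IsWolffProfile p w)
    (hΩ : IsOpen Ω) (hΩb : Bornology.IsBounded Ω)
    (hρ : ‖ρ‖ = 1) (hρ' : ‖ρ'‖ = 1) (hρρ' : inner ℝ ρ ρ' = 0) (hτ : 0 < τ) {U : W1p Ω p}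
    (hU : U.1.2 =ᵐ[volume.restrict Ω] wolffGradient w t ρ ρ' τ) {g : W1p Ω p}
    (hg : g ∈ W01p Ω p) : flux Ω p (fun _ => 1) U g = 0 := by
  obtain ⟨L, hL⟩ := (isConductivity_one (Ω := Ω)).exists_clm_flux U
  have hcl : IsClosed {g : W1p Ω p | L g = 0} := isClosed_eq L.continuous continuous_const
  rw [← hL]
  refine closure_minimal ?_ hcl hg
  rintro g ⟨φ, hφ, hgφ⟩
  refine (hL g).trans ?_
  rw [← hw.integral_wolffGradient_eq_zero hp.out hρ hρ' hρρ' hτ hφ (t := t), flux]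
  refine integral_congr_ae ?_
  filter_upwards [hU, testSubmodule_gradient_ae_eq hΩ hΩb hφ hgφ] with x h1 h2
  rw [h1, h2, one_mul]

/-- The boundary values of a Wolff solution are those of a `p`-harmonic function with the
expected gradient. -/
theorem IsWolffProfile.exists_boundaryValueOfFun_eq [hp : Fact (1 < p)] (hw : IsWolffProfile p w)
    (hΩ : IsOpen Ω) (hΩb : Bornology.IsBounded Ω)
    (hρ : ‖ρ‖ = 1) (hρ' : ‖ρ'‖ = 1) (hρρ' : inner ℝ ρ ρ' = 0) (hτ : 0 < τ) :
    ∃ U : W1p Ω p, boundaryValueOfFun Ω p (wolffSolution w t ρ ρ' τ) = boundaryValue Ω p U ∧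
      U.1.2 =ᵐ[volume.restrict Ω] wolffGradient w t ρ ρ' τ ∧
      ∀ g ∈ W01p Ω p, flux Ω p (fun _ => 1) U g = 0 := by
  have hc := hw.contDiff_wolffSolution t τ ρ ρ'
  have hGc := hw.continuous_wolffGradient t τ ρ ρ'
  have hG := hw.fderiv_wolffSolution t τ ρ ρ'
  have hex : ∃ u : W1p Ω p, u.1.1 =ᵐ[volume.restrict Ω] wolffSolution w t ρ ρ' τ := by
    obtain ⟨U, hU, -⟩ := exists_W1p_of_contDiff (p := p) hΩb hc hGc hG
    exact ⟨U, hU⟩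
  have hgrad := gradient_ae_eq_of_contDiff hΩ hΩb hc hGc hG hex.choose_spec
  exact ⟨hex.choose, dif_pos hex, hgrad, fun g hg =>
    hw.flux_eq_zero hΩ hΩb hρ hρ' hρρ' hτ hgrad hg⟩

end Wolff

/-! ### The indicator function -/

section Indicator

variable {d : ℕ} {Ω D : Set (E d)} {p : ℝ} [hp : Fact (1 < p)] {σ : E d → ℝ} {a b : ℝ}

theorem isConductivity_of_bounds (hσm : AEMeasurable σ (volume.restrict Ω)) (hΩ : IsOpen Ω)
    (ha : 0 < a) (h1 : ∀ x ∈ Ω \ D, σ x = 1) (hab : ∀ x ∈ D, a ≤ σ x ∧ σ x ≤ b) :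
    IsConductivity Ω σ (min a 1) (max b 1) := by
  refine ⟨hσm, lt_min ha one_pos, ?_⟩
  filter_upwards [ae_restrict_mem hΩ.measurableSet] with x hx
  by_cases hxD : x ∈ D
  · exact ⟨(min_le_left _ _).trans (hab x hxD).1, (hab x hxD).2.trans (le_max_left _ _)⟩
  · rw [h1 x ⟨hx, hxD⟩]
    exact ⟨min_le_right _ _, le_max_right _ _⟩

/-- The energy of `u` over the inclusion `D`, as an integral over `Ω`. -/
theorem integral_indicator_gradient (hD : IsOpen D) (hDΩ : D ⊆ Ω) (u : W1p Ω p) :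
    Integrable (D.indicator fun x => ‖u.1.2 x‖ ^ p) (volume.restrict Ω) ∧
      ∫ x in Ω, D.indicator (fun x => ‖u.1.2 x‖ ^ p) x = ∫ x in D, ‖u.1.2 x‖ ^ p := by
  refine ⟨(integrable_norm_rpow (Lp.memLp u.1.2)).indicator hD.measurableSet, ?_⟩
  rw [setIntegral_indicator hD.measurableSet, Set.inter_eq_self_of_subset_right hDΩ]

theorem energy_le_of_bounds (hσm : AEMeasurable σ (volume.restrict Ω)) (hΩ : IsOpen Ω)
    (hD : IsOpen D) (hDΩ : D ⊆ Ω) (ha : 0 < a) (h1 : ∀ x ∈ Ω \ D, σ x = 1)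
    (hab : ∀ x ∈ D, a ≤ σ x ∧ σ x ≤ b) (u : W1p Ω p) :
    energy Ω p σ u ≤ energy Ω p (fun _ => 1) u + (b - 1) * ∫ x in D, ‖u.1.2 x‖ ^ p := by
  obtain ⟨hi, he⟩ := integral_indicator_gradient hD hDΩ u
  have hi1 := (isConductivity_one (Ω := Ω)).integrable_energy u.1.2
  rw [← he, energy, energy, ← integral_const_mul, ← integral_add hi1 (hi.const_mul _)]
  refine integral_mono_ae ((isConductivity_of_bounds hσm hΩ ha h1 hab).integrable_energy u.1.2)
    (hi1.add (hi.const_mul _)) ?_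
  filter_upwards [ae_restrict_mem hΩ.measurableSet] with x hx
  by_cases hxD : x ∈ D
  · rw [Set.indicator_of_mem hxD]
    have := mul_le_mul_of_nonneg_right (hab x hxD).2 (by positivity : 0 ≤ ‖u.1.2 x‖ ^ p)
    linarith
  · rw [Set.indicator_of_notMem hxD, h1 x ⟨hx, hxD⟩, mul_zero, add_zero]

/-- Since `v - u` lies in `W_0^{1,p}`, the flux of `u` against `v` equals the energy of `u`, so that
energy is `p` times this flux minus `p - 1` times itself. `weighted_young` with `s = a` in `D` and
`s = 1` outside bounds the integrand by `σ|∇v|^p`. -/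
theorem le_energy_of_bounds (hσm : AEMeasurable σ (volume.restrict Ω)) (hΩ : IsOpen Ω)
    (hD : IsOpen D) (hDΩ : D ⊆ Ω) (ha : 0 < a) (h1 : ∀ x ∈ Ω \ D, σ x = 1)
    (hab : ∀ x ∈ D, a ≤ σ x ∧ σ x ≤ b) {u : W1p Ω p}
    (hu : ∀ g ∈ W01p Ω p, flux Ω p (fun _ => 1) u g = 0) {v : W1p Ω p}
    (hv : boundaryValue Ω p v = boundaryValue Ω p u) :
    energy Ω p (fun _ => 1) u + (p - 1) * (1 - a ^ (-(1 / (p - 1)))) * ∫ x in D, ‖u.1.2 x‖ ^ p ≤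
      energy Ω p σ v := by
  have hone := isConductivity_one (Ω := Ω)
  obtain ⟨hi, he⟩ := integral_indicator_gradient hD hDΩ u
  have hflux : flux Ω p (fun _ => 1) u v = energy Ω p (fun _ => 1) u := by
    have h := hu _ (boundaryValue_eq_iff.1 hv)
    rw [hone.flux_sub, flux_self] at h
    linarith
  have hi1 := hone.integrable_energy u.1.2
  have hi2 := hone.integrable_flux u.1.2 v.1.2
  have hi3 : Integrable (fun x => p * (1 * (‖u.1.2 x‖ ^ (p - 2) * inner ℝ (u.1.2 x) (v.1.2 x))) -
      (p - 1) * (1 * ‖u.1.2 x‖ ^ p)) (volume.restrict Ω) :=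
    (hi2.const_mul p).sub (hi1.const_mul (p - 1))
  have hfl : flux Ω p (fun _ => 1) u v =
      ∫ x in Ω, 1 * (‖u.1.2 x‖ ^ (p - 2) * inner ℝ (u.1.2 x) (v.1.2 x)) := by
    rw [flux]; simp only [mul_assoc]
  have hsplit : energy Ω p (fun _ => 1) u = p * flux Ω p (fun _ => 1) u v -
      (p - 1) * energy Ω p (fun _ => 1) u := by rw [hflux]; ring
  rw [hsplit, ← he, hfl, energy, energy, ← integral_const_mul, ← integral_const_mul,
    ← integral_const_mul, ← integral_sub (hi2.const_mul p) (hi1.const_mul (p - 1)),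
    ← integral_add hi3 (hi.const_mul _)]
  refine integral_mono_ae (hi3.add (hi.const_mul _))
    ((isConductivity_of_bounds hσm hΩ ha h1 hab).integrable_energy v.1.2) ?_
  filter_upwards [ae_restrict_mem hΩ.measurableSet] with x hx
  by_cases hxD : x ∈ D
  · rw [Set.indicator_of_mem hxD]
    have h2 := weighted_young hp.out ha (u.1.2 x) (v.1.2 x)
    have h3 := mul_le_mul_of_nonneg_right (hab x hxD).1 (by positivity : 0 ≤ ‖v.1.2 x‖ ^ p)
    linarith
  · rw [Set.indicator_of_notMem hxD, h1 x ⟨hx, hxD⟩]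
    have h2 := weighted_young hp.out one_pos (u.1.2 x) (v.1.2 x)
    rw [Real.one_rpow] at h2
    linarith

/-- The monotonicity inequalities for the difference of the Dirichlet to Neumann maps. -/
theorem dnMap_sub_bounds (hd : 0 < d) (hσm : AEMeasurable σ (volume.restrict Ω)) (hΩ : IsOpen Ω)
    (hΩb : Bornology.IsBounded Ω) (hD : IsOpen D) (hDΩ : D ⊆ Ω) (ha : 0 < a)
    (h1 : ∀ x ∈ Ω \ D, σ x = 1) (hab : ∀ x ∈ D, a ≤ σ x ∧ σ x ≤ b) {u : W1p Ω p}
    (hu : ∀ g ∈ W01p Ω p, flux Ω p (fun _ => 1) u g = 0) {f : BoundarySpace Ω p}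
    (hf : f = boundaryValue Ω p u) :
    (p - 1) * (1 - a ^ (-(1 / (p - 1)))) * (∫ x in D, ‖u.1.2 x‖ ^ p) ≤
        (dnMap Ω p σ f - dnMap Ω p (fun _ => 1) f) f ∧
      (dnMap Ω p σ f - dnMap Ω p (fun _ => 1) f) f ≤ (b - 1) * ∫ x in D, ‖u.1.2 x‖ ^ p := by
  subst hf
  obtain ⟨v, hv, hvE⟩ := (isConductivity_of_bounds hσm hΩ ha h1 hab).dnMap_apply_self hd hΩ hΩb
    (boundaryValue Ω p u)
  obtain ⟨z, hz, hzE⟩ := (isConductivity_one (Ω := Ω)).dnMap_apply_self hd hΩ hΩb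
    (boundaryValue Ω p u)
  -- The minimizer behind `dnMap` need not be identified with `u`; equality of minimal energies is
  -- enough.
  have hzu : energy Ω p (fun _ => 1) z = energy Ω p (fun _ => 1) u :=
    le_antisymm (hz.2 u rfl) ((isMinimizer_one_of_flux_eq_zero hu).2 z hz.1)
  have heq : (dnMap Ω p σ (boundaryValue Ω p u) - dnMap Ω p (fun _ => 1) (boundaryValue Ω p u))
      (boundaryValue Ω p u) = energy Ω p σ v - energy Ω p (fun _ => 1) u :=
    (congrArg₂ (· - ·) hvE hzE).trans (congrArg _ hzu)
  rw [heq]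
  have hlow := le_energy_of_bounds hσm hΩ hD hDΩ ha h1 hab hu hv.1
  have hup := (hv.2 u rfl).trans (energy_le_of_bounds hσm hΩ hD hDΩ ha h1 hab u)
  constructor <;> linarith

theorem rpow_neg_lt_one {p : ℝ} (hp : 1 < p) (ha : 1 < a) : a ^ (-(1 / (p - 1))) < 1 :=
  Real.rpow_lt_one_of_one_lt_of_neg ha (by
    have : 0 < p - 1 := by linarith
    simpa using this)

theorem one_lt_rpow_neg {p : ℝ} (hp : 1 < p) (ha : 0 < a) (ha1 : a < 1) : 1 < a ^ (-(1 / (p - 1))) :=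
  Real.one_lt_rpow_of_pos_of_lt_one_of_neg ha ha1 (by
    have : 0 < p - 1 := by linarith
    simpa using this)

-- The monotonicity constants `b - 1` and `(p-1)(1 - a^(-1/(p-1)))` are both negative when `b < 1`
-- and both positive when `a > 1`. A point of `D` is used to get `a < b`.
set_option maxHeartbeats 1000000 in
theorem IsFiniteInclusion.exists_abs_dnMap_sub_bounds (hσ : IsFiniteInclusion Ω D σ)
    (hd : 0 < d) (hσm : AEMeasurable σ (volume.restrict Ω)) (hΩ : IsOpen Ω)
    (hΩb : Bornology.IsBounded Ω) (hD : IsOpen D) (hDne : D.Nonempty) (hDΩ : D ⊆ Ω) :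
    ∃ c₁ c₂ : ℝ, 0 < c₁ ∧ 0 < c₂ ∧ ∀ (u : W1p Ω p) (f : BoundarySpace Ω p),
      (∀ g ∈ W01p Ω p, flux Ω p (fun _ => 1) u g = 0) → f = boundaryValue Ω p u →
      c₁ * (∫ x in D, ‖u.1.2 x‖ ^ p) ≤ |(dnMap Ω p σ f - dnMap Ω p (fun _ => 1) f) f| ∧
        |(dnMap Ω p σ f - dnMap Ω p (fun _ => 1) f) f| ≤ c₂ * ∫ x in D, ‖u.1.2 x‖ ^ p := by
  have hp1 : 0 < p - 1 := sub_pos.2 hp.out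
  obtain ⟨h1, ⟨a, b, ha, hb, hab⟩ | ⟨a, b, ha, hab⟩⟩ := hσ
  · obtain ⟨x₀, hx₀⟩ := hDne
    have ha1 : a < 1 := (hab x₀ hx₀).1.trans ((hab x₀ hx₀).2.trans hb)
    have hs := one_lt_rpow_neg hp.out ha ha1
    refine ⟨1 - b, (p - 1) * (a ^ (-(1 / (p - 1))) - 1), by linarith,
      mul_pos hp1 (by linarith), fun u f hu hf => ?_⟩
    obtain ⟨hl, hr⟩ := dnMap_sub_bounds hd hσm hΩ hΩb hD hDΩ ha h1
      (fun x hx => ⟨(hab x hx).1.le, (hab x hx).2.le⟩) hu hf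
    have hJ : 0 ≤ ∫ x in D, ‖u.1.2 x‖ ^ p := integral_nonneg fun x => by positivity
    have hneg : (b - 1) * (∫ x in D, ‖u.1.2 x‖ ^ p) ≤ 0 :=
      mul_nonpos_of_nonpos_of_nonneg (by linarith) hJ
    rw [abs_of_nonpos (hr.trans hneg)]
    constructor <;> linarith
  · obtain ⟨x₀, hx₀⟩ := hDne
    have hb1 : 1 < b := ha.trans ((hab x₀ hx₀).1.trans (hab x₀ hx₀).2)
    have hs := rpow_neg_lt_one hp.out ha
    have hc : 0 < (p - 1) * (1 - a ^ (-(1 / (p - 1)))) := mul_pos hp1 (by linarith)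
    refine ⟨_, b - 1, hc, by linarith, fun u f hu hf => ?_⟩
    obtain ⟨hl, hr⟩ := dnMap_sub_bounds hd hσm hΩ hΩb hD hDΩ (one_pos.trans ha) h1
      (fun x hx => ⟨(hab x hx).1.le, (hab x hx).2.le⟩) hu hf
    have hJ : 0 ≤ ∫ x in D, ‖u.1.2 x‖ ^ p := integral_nonneg fun x => by positivity
    rw [abs_of_nonneg ((mul_nonneg hc.le hJ).trans hl)]
    exact ⟨hl, hr⟩

/-- The indicator function is comparable to `τ ^ d ∫_D e^{p τ (ρ · x - t)} dx`. -/
theorem exists_indicatorFun_bounds (hd : 0 < d) (hΩ : IsOpen Ω) (hΩb : Bornology.IsBounded Ω)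
    (hD : IsOpen D) (hDne : D.Nonempty) (hDΩ : D ⊆ Ω)
    (hσm : AEMeasurable σ (volume.restrict Ω)) (hσ : IsFiniteInclusion Ω D σ)
    {w : ℝ → ℝ} (hw : IsWolffProfile p w) :
    ∃ c₁ c₂ : ℝ, 0 < c₁ ∧ 0 < c₂ ∧ ∀ ρ ρ' : E d, ‖ρ‖ = 1 → ‖ρ'‖ = 1 → inner ℝ ρ ρ' = 0 →
      ∀ t τ : ℝ, 0 < τ →
        c₁ * (τ ^ d * ∫ x in D, Real.exp (p * τ * (inner ℝ ρ x - t))) ≤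
          |indicatorFun Ω p σ w t ρ ρ' τ| ∧
        |indicatorFun Ω p σ w t ρ ρ' τ| ≤
          c₂ * (τ ^ d * ∫ x in D, Real.exp (p * τ * (inner ℝ ρ x - t))) := by
  have hp0 : 0 < p := one_pos.trans hp.out
  obtain ⟨c₁, c₂, hc₁, hc₂, H⟩ :=
    hσ.exists_abs_dnMap_sub_bounds (p := p) hd hσm hΩ hΩb hD hDne hDΩ
  -- These bounds depend only on the profile, hence the uniformity in `ρ`, `ρ'`, `t` and `τ`.
  obtain ⟨m, M, hm, hmM⟩ := hw.exists_radiusSq_bounds hp.out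
  have hM : 0 < M := hm.trans_le ((hmM 0).1.trans (hmM 0).2)
  refine ⟨c₁ * m ^ (p / 2), c₂ * M ^ (p / 2), by positivity, by positivity,
    fun ρ ρ' hρ hρ' hρρ' t τ hτ => ?_⟩
  obtain ⟨U, hUb, hUg, hUf⟩ :=
    hw.exists_boundaryValueOfFun_eq hΩ hΩb hρ hρ' hρρ' hτ (t := t)
  obtain ⟨hl, hr⟩ := H U _ hUf hUb
  have hτd : τ ^ ((d : ℝ) - p) * τ ^ p = τ ^ d := by
    rw [← Real.rpow_add hτ, sub_add_cancel, Real.rpow_natCast]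
  have hgrad : ∀ᵐ x ∂(volume.restrict D), ‖U.1.2 x‖ ^ p =
      τ ^ p * Real.exp (p * τ * (inner ℝ ρ x - t)) * radiusSq w (τ * inner ℝ ρ' x) ^ (p / 2) := by
    filter_upwards [ae_restrict_of_ae_restrict_of_subset hDΩ hUg] with x hx
    rw [hx, norm_wolffGradient_rpow hρ hρ' hρρ' hτ]
  have hexp := integrableOn_exp_inner (hΩb.subset hDΩ) ρ (p * τ) t
  have hUint : IntegrableOn (fun x => ‖U.1.2 x‖ ^ p) D :=
    IntegrableOn.mono_set (integrable_norm_rpow (Lp.memLp U.1.2)) hDΩ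
  have hJl : m ^ (p / 2) * τ ^ p * (∫ x in D, Real.exp (p * τ * (inner ℝ ρ x - t))) ≤
      ∫ x in D, ‖U.1.2 x‖ ^ p := by
    rw [← integral_const_mul]
    refine integral_mono_ae (hexp.const_mul _) hUint ?_
    filter_upwards [hgrad] with x hx
    rw [hx]
    have := Real.rpow_le_rpow hm.le (hmM (τ * inner ℝ ρ' x)).1 (by positivity : 0 ≤ p / 2)
    have := mul_le_mul_of_nonneg_left this
      (by positivity : 0 ≤ τ ^ p * Real.exp (p * τ * (inner ℝ ρ x - t)))
    linarith
  have hJr : ∫ x in D, ‖U.1.2 x‖ ^ p ≤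
      M ^ (p / 2) * τ ^ p * ∫ x in D, Real.exp (p * τ * (inner ℝ ρ x - t)) := by
    rw [← integral_const_mul]
    refine integral_mono_ae hUint (hexp.const_mul _) ?_
    filter_upwards [hgrad] with x hx
    rw [hx]
    have := Real.rpow_le_rpow (radiusSq_nonneg _) (hmM (τ * inner ℝ ρ' x)).2
      (by positivity : 0 ≤ p / 2)
    have := mul_le_mul_of_nonneg_left this
      (by positivity : 0 ≤ τ ^ p * Real.exp (p * τ * (inner ℝ ρ x - t)))
    linarith
  have hτp : 0 ≤ τ ^ ((d : ℝ) - p) := by positivity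
  rw [indicatorFun, abs_mul, abs_of_nonneg hτp, ← hτd]
  constructor
  · refine le_trans (le_of_eq ?_) (mul_le_mul_of_nonneg_left
      ((mul_le_mul_of_nonneg_left hJl hc₁.le).trans hl) hτp)
    ring
  · refine (mul_le_mul_of_nonneg_left
      (hr.trans (mul_le_mul_of_nonneg_left hJr hc₂.le)) hτp).trans (le_of_eq ?_)
    ring

end Indicator

/-! ### Asymptotics of the indicator function and recovery of the convex hull. -/

variable {d : ℕ} {Ω D : Set (E d)} {p : ℝ} [hp : Fact (1 < p)] {σ : E d → ℝ} {w : ℝ → ℝ}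

/-- At the support value, the indicator function is bounded below and grows at most like `τ ^ d`,
uniformly in the direction. -/
theorem indicatorFun_bounds_at_support (hd : 0 < d) (hΩ : IsOpen Ω)
    (hΩb : Bornology.IsBounded Ω) (hD : IsOpen D) (hDne : D.Nonempty) (hDΩ : D ⊆ Ω)
    (hDlip : HasLipschitzBoundary D) (hσm : AEMeasurable σ (volume.restrict Ω))
    (hσ : IsFiniteInclusion Ω D σ) (hw : IsWolffProfile p w) :
    ∃ c C τ₀ : ℝ, 0 < c ∧ 0 < C ∧ 0 < τ₀ ∧
      ∀ ρ ρ' : E d, ‖ρ‖ = 1 → ‖ρ'‖ = 1 → inner ℝ ρ ρ' = 0 → ∀ τ : ℝ, τ₀ ≤ τ →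
        c < |indicatorFun Ω p σ w (supportFun D ρ) ρ ρ' τ| ∧
        |indicatorFun Ω p σ w (supportFun D ρ) ρ ρ' τ| < C * τ ^ d := by
  have hp0 : 0 < p := one_pos.trans hp.out
  have hDb := hΩb.subset hDΩ
  obtain ⟨c₁, c₂, hc₁, hc₂, H⟩ := exists_indicatorFun_bounds hd hΩ hΩb hD hDne hDΩ hσm hσ hw
  obtain ⟨c, τ₀, hc, hτ₀, hlow⟩ := exists_le_integral_exp hD hDne hDb hDlip hp0
  -- Halving the lower constant and adding one to the upper one turn the weak inequalities into
  -- strict ones.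
  refine ⟨c₁ * c / 2, c₂ * volume.real D + 1, τ₀, by positivity, by positivity, hτ₀,
    fun ρ ρ' hρ hρ' hρρ' τ hτ => ?_⟩
  have hτ0 : 0 < τ := hτ₀.trans_le hτ
  obtain ⟨hl, hr⟩ := H ρ ρ' hρ hρ' hρρ' (supportFun D ρ) τ hτ0
  constructor
  · have h1 := mul_le_mul_of_nonneg_left (hlow ρ hρ τ hτ) hc₁.le
    have h2 : 0 < c₁ * c := mul_pos hc₁ hc
    linarith
  · have h1 := integral_exp_le hD hDb ρ (mul_pos hp0 hτ0).le (supportFun D ρ)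
    rw [sub_self, mul_zero, Real.exp_zero, mul_one] at h1
    have hτd : 0 < τ ^ d := by positivity
    have h2 := mul_le_mul_of_nonneg_left (mul_le_mul_of_nonneg_left h1 hτd.le) hc₂.le
    refine (hr.trans h2).trans_lt ?_
    linarith

theorem tendsto_indicatorFun_zero (hd : 0 < d) (hΩ : IsOpen Ω)
    (hΩb : Bornology.IsBounded Ω) (hD : IsOpen D) (hDne : D.Nonempty) (hDΩ : D ⊆ Ω)
    (hσm : AEMeasurable σ (volume.restrict Ω))
    (hσ : IsFiniteInclusion Ω D σ) (hw : IsWolffProfile p w) {ρ ρ' : E d} (hρ : ‖ρ‖ = 1)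
    (hρ' : ‖ρ'‖ = 1) (hρρ' : inner ℝ ρ ρ' = 0) {t : ℝ} (ht : supportFun D ρ < t) :
    Tendsto (fun τ => indicatorFun Ω p σ w t ρ ρ' τ) atTop (𝓝 0) := by
  have hp0 : 0 < p := one_pos.trans hp.out
  have hDb := hΩb.subset hDΩ
  obtain ⟨c₁, c₂, hc₁, hc₂, H⟩ := exists_indicatorFun_bounds hd hΩ hΩb hD hDne hDΩ hσm hσ hw
  have hlim := (tendsto_rpow_mul_exp_neg_mul_atTop_nhds_zero (d : ℝ) (p * (t - supportFun D ρ))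
    (mul_pos hp0 (sub_pos.2 ht))).const_mul (c₂ * volume.real D)
  rw [mul_zero] at hlim
  refine squeeze_zero_norm' ?_ hlim
  filter_upwards [eventually_gt_atTop 0] with τ hτ
  have h1 := integral_exp_le hD hDb ρ (mul_pos hp0 hτ).le t
  have hτd : 0 < τ ^ d := by positivity
  have h2 := mul_le_mul_of_nonneg_left (mul_le_mul_of_nonneg_left h1 hτd.le) hc₂.le
  refine ((H ρ ρ' hρ hρ' hρρ' t τ hτ).2.trans h2).trans (le_of_eq ?_)
  rw [Real.rpow_natCast, show p * τ * (supportFun D ρ - t) = -(p * (t - supportFun D ρ)) * τ by ring]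
  ring

/-- Replacing the support value by `t` extracts the factor `e^{p(h_D(ρ) - t)τ}`, which grows
exponentially, from an integral already bounded below by a multiple of `τ^{-d}`. -/
theorem tendsto_abs_indicatorFun_atTop (hd : 0 < d) (hΩ : IsOpen Ω)
    (hΩb : Bornology.IsBounded Ω) (hD : IsOpen D) (hDne : D.Nonempty) (hDΩ : D ⊆ Ω)
    (hDlip : HasLipschitzBoundary D) (hσm : AEMeasurable σ (volume.restrict Ω))
    (hσ : IsFiniteInclusion Ω D σ) (hw : IsWolffProfile p w) {ρ ρ' : E d} (hρ : ‖ρ‖ = 1)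
    (hρ' : ‖ρ'‖ = 1) (hρρ' : inner ℝ ρ ρ' = 0) {t : ℝ} (ht : t < supportFun D ρ) :
    Tendsto (fun τ => |indicatorFun Ω p σ w t ρ ρ' τ|) atTop atTop := by
  have hp0 : 0 < p := one_pos.trans hp.out
  have hDb := hΩb.subset hDΩ
  obtain ⟨c₁, c₂, hc₁, hc₂, H⟩ := exists_indicatorFun_bounds hd hΩ hΩb hD hDne hDΩ hσm hσ hw
  obtain ⟨c, τ₀, hc, hτ₀, hlow⟩ := exists_le_integral_exp hD hDne hDb hDlip hp0
  have hlim : Tendsto (fun τ : ℝ => c₁ * c * Real.exp (p * (supportFun D ρ - t) * τ))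
      atTop atTop :=
    (Real.tendsto_exp_atTop.comp (tendsto_id.const_mul_atTop
      (mul_pos hp0 (sub_pos.2 ht)))).const_mul_atTop (mul_pos hc₁ hc)
  refine tendsto_atTop_mono' _ ?_ hlim
  filter_upwards [eventually_ge_atTop τ₀] with τ hτ
  have hτ0 : 0 < τ := hτ₀.trans_le hτ
  have hshift : ∫ x in D, Real.exp (p * τ * (inner ℝ ρ x - t)) =
      Real.exp (p * (supportFun D ρ - t) * τ) *
        ∫ x in D, Real.exp (p * τ * (inner ℝ ρ x - supportFun D ρ)) := by
    rw [← integral_const_mul]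
    refine integral_congr_ae (ae_of_all _ fun x => ?_)
    simp only [← Real.exp_add]
    congr 1
    ring
  refine le_trans ?_ (H ρ ρ' hρ hρ' hρρ' t τ hτ0).1
  rw [hshift]
  have h := mul_le_mul_of_nonneg_left (hlow ρ hρ τ hτ)
    (by positivity : 0 ≤ c₁ * Real.exp (p * (supportFun D ρ - t) * τ))
  linarith

end Enclosure

theorem mainTheorem6 {d : ℕ} (hd : 2 ≤ d) (p : ℝ) [Fact (1 < p)]
    (Ω D : Set (Enclosure.E d)) (hΩ : IsOpen Ω) (hΩb : Bornology.IsBounded Ω)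
    (hD : IsOpen D) (hDne : D.Nonempty) (hDΩ : D ⊆ Ω)
    (hDlip : Enclosure.HasLipschitzBoundary D)
    (σ : Enclosure.E d → ℝ) (hσm : AEMeasurable σ (volume.restrict Ω))
    (hσ : Enclosure.IsFiniteInclusion Ω D σ)
    (w : ℝ → ℝ) (hw : Enclosure.IsWolffProfile p w) :
    (∃ c C τ₀ : ℝ, 0 < c ∧ 0 < C ∧ 0 < τ₀ ∧
      ∀ ρ ρ' : Enclosure.E d, ‖ρ‖ = 1 → ‖ρ'‖ = 1 → inner ℝ ρ ρ' = 0 → ∀ τ : ℝ, τ₀ ≤ τ →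
        c < |Enclosure.indicatorFun Ω p σ w (Enclosure.supportFun D ρ) ρ ρ' τ| ∧
        |Enclosure.indicatorFun Ω p σ w (Enclosure.supportFun D ρ) ρ ρ' τ| < C * τ ^ d) ∧
    (∀ ρ ρ' : Enclosure.E d, ‖ρ‖ = 1 → ‖ρ'‖ = 1 → inner ℝ ρ ρ' = 0 → ∀ t : ℝ,
      (Enclosure.supportFun D ρ < t →
        Tendsto (fun τ => Enclosure.indicatorFun Ω p σ w t ρ ρ' τ) atTop (𝓝 0)) ∧
      (t < Enclosure.supportFun D ρ →
        Tendsto (fun τ => |Enclosure.indicatorFun Ω p σ w t ρ ρ' τ|) atTop atTop)) ∧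
    convexHull ℝ D = interior {x : Enclosure.E d |
      ∀ ρ ρ' : Enclosure.E d, ‖ρ‖ = 1 → ‖ρ'‖ = 1 → inner ℝ ρ ρ' = 0 → ∀ t : ℝ,
        Tendsto (fun τ => Enclosure.indicatorFun Ω p σ w t ρ ρ' τ) atTop (𝓝 0) →
          inner ℝ ρ x ≤ t} := by
  have hd0 : 0 < d := by omega
  have hzero {ρ ρ' : Enclosure.E d} (hρ : ‖ρ‖ = 1) (hρ' : ‖ρ'‖ = 1) (hρρ' : inner ℝ ρ ρ' = 0)
      {t : ℝ} (ht : Enclosure.supportFun D ρ < t) :=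
    Enclosure.tendsto_indicatorFun_zero hd0 hΩ hΩb hD hDne hDΩ hσm hσ hw hρ hρ' hρρ' ht
  have htop {ρ ρ' : Enclosure.E d} (hρ : ‖ρ‖ = 1) (hρ' : ‖ρ'‖ = 1) (hρρ' : inner ℝ ρ ρ' = 0)
      {t : ℝ} (ht : t < Enclosure.supportFun D ρ) :=
    Enclosure.tendsto_abs_indicatorFun_atTop hd0 hΩ hΩb hD hDne hDΩ hDlip hσm hσ hw hρ hρ' hρρ' ht
  refine ⟨Enclosure.indicatorFun_bounds_at_support hd0 hΩ hΩb hD hDne hDΩ hDlip hσm hσ hw,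
    fun ρ ρ' hρ hρ' hρρ' t => ⟨hzero hρ hρ' hρρ', htop hρ hρ' hρρ'⟩, ?_⟩
  rw [Enclosure.convexHull_eq_interior_halfSpaces hD hDne (hΩb.subset hDΩ)]
  congr 1
  ext x
  refine ⟨fun hx ρ ρ' hρ hρ' hρρ' t hlim => ?_, fun hx ρ hρ => ?_⟩
  -- A limit zero is incompatible with blow-up, so an admissible `t` is at least the support value.
  · refine (hx ρ hρ).trans (not_lt.1 fun ht => ?_)
    have habs := hlim.abs
    rw [abs_zero] at habs
    exact not_tendsto_nhds_of_tendsto_atTop (htop hρ hρ' hρρ' ht) 0 habs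
  -- Every `t` above the support value is admissible, and `t` may decrease to it; the behaviour at
  -- the support value itself plays no role.
  · obtain ⟨ρ', hρ', hρρ'⟩ := Enclosure.exists_orthonormal_partner hd ρ
    exact le_of_forall_gt_imp_ge_of_dense fun t ht =>
      hx ρ ρ' hρ hρ' hρρ' t (hzero hρ hρ' hρρ' ht)
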